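/- Let $\mathbb N=\{0,1,2,\dots\}$. For $x\in\mathbb N\setminus\{0\}$ let $\lambda(x)$ and $\mu(x)$ be the smallest and the largest position of a nonzero digit in the binary expansion of $x$ (so $2^{\lambda(x)}\mid x$, $2^{\lambda(x)+1}\nmid x$ and $\mu(x)=\lfloor\log_2 x\rfloor$). A finite colouring of a set $A$ is a function $c:A\to\{0,\dots,k-1\}$ for some $k\in\mathbb N$. A finite colouring $c$ of the set $[\mathbb N]^n$ of $n$-element subsets of $\mathbb N$ is *$\mathbb Z$-invariant* if $c(\{x_1+z,\dots,x_n+z\})=c(\{x_1,\dots,x_n\})$ for all $\{x_1,\dots,x_n\}\in[\mathbb N]^n$ and $z\in\mathbb N$. An infinite set $X\subseteq\mathbb N$ with increasing enumeration $x_0<x_1<\cdots$ satisfies the *separation condition* if $\mu(x_n-x_{n-1})<\lambda(x_{n+1}-x_n)$ for all $n\ge 1$. An infinite set $Y\subseteq\mathbb N\setminus\{0\}$ with increasing enumeration $y_0<y_1<\cdots$ satisfies the *apartness condition* if $\mu(y_n)<\lambda(y_{n+1})$ for all $n\geq 0$. For $d\ge 1$ let $$\mathrm{AFS}^d(Y)=\Big\{\Big(\sum_{k=k_0}^{k_1}y_k,\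 \sum_{k=k_1+1}^{k_2}y_k,\ \dots,\ \sum_{k=k_{d-1}+1}^{k_d}y_k\Big)\ :\ k_0\le k_1<k_2<\cdots<k_d\Big\}\subseteq\mathbb N^d .$$ * $\mathrm{sep}\mathbb Z\text{-}\mathsf{RT}^{n}$ is the statement that for every $\mathbb Z$-invariant finite colouring $c$ of $[\mathbb N]^n$ there is an infinite set $X$ that satisfies the separation condition and for which $c$ is constant on $[X]^n$. As a problem, its instances are the colourings $c$ and the solutions to $c$ are the sets $X$. * $\mathrm{ap}\mathsf{AHT}^d$ is the statement that for every finite colouring $c$ of $\mathbb N^d$ there is an infinite set $Y$ that satisfies the apartness condition and for which $c$ is constant on $\mathrm{AFS}^d(Y)$. As a problem, its instances are the colourings $c$ and the solutions to $c$ are the sets $Y$. A problem $P$ is *strongly Weihrauch reducible* to a problem $Q$ if there are Turing functionals $\Phi,\Psi$ such that for every instance $c$ of $P$, $\Phi^c$ is an instance of $Q$, and for every solution $Y$ to $\Phi^c$, $\Psi^Y$ is a solution to $c$. Two problems are *strongly Weihrauch equivalent* if each of them is strongly Weihrauch reducible to the other. **Theorem.** Let $d\ge 1$. 1. The problems $\mathrm{sep}\mathbb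 Z\text{-}\mathsf{RT}^{d+1}$ and $\mathrm{ap}\mathsf{AHT}^d$ are strongly Weihrauch equivalent. 2. The statements $\mathrm{sep}\mathbb Z\text{-}\mathsf{RT}^{d+1}$ and $\mathrm{ap}\mathsf{AHT}^d$ are equivalent over $\mathsf{RCA}_0$; that is, every model of $\mathsf{RCA}_0$ (with a possibly nonstandard first-order part) satisfies one of them if and only if it satisfies the other. -/

import Mathlib

universe u

/-! ## Turing functionals and strong Weihrauch reducibility -/

namespace Weihrauch

/-- Turing functionals: the partial functionals `Φ`, with `Φ X n` the value (if any) of the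
computation with oracle `X : ℕ → ℕ` on input `n`. This is the uniform version of
`Nat.RecursiveIn`: the same scheme of computation is used for all oracles. -/
inductive IsTuringFunctional : ((ℕ → ℕ) → ℕ →. ℕ) → Prop
  | zero : IsTuringFunctional fun _ _ => Part.some 0
  | succ : IsTuringFunctional fun _ n => Part.some (n + 1)
  | left : IsTuringFunctional fun _ n => Part.some (Nat.unpair n).1
  | right : IsTuringFunctional fun _ n => Part.some (Nat.unpair n).2
  | oracle : IsTuringFunctional fun X n => Part.some (X n)
  | pair {F G : (ℕ → ℕ) → ℕ →. ℕ} (hF : IsTuringFunctional F) (hG : IsTuringFunctional G) :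
      IsTuringFunctional fun X n => Nat.pair <$> F X n <*> G X n
  | comp {F G : (ℕ → ℕ) → ℕ →. ℕ} (hF : IsTuringFunctional F) (hG : IsTuringFunctional G) :
      IsTuringFunctional fun X n => G X n >>= F X
  | prec {F G : (ℕ → ℕ) → ℕ →. ℕ} (hF : IsTuringFunctional F) (hG : IsTuringFunctional G) :
      IsTuringFunctional fun X p =>
        let (a, n) := Nat.unpair p
        n.rec (F X a) fun y IH => do
          let i ← IH
          G X (Nat.pair a (Nat.pair y i))
  | rfind {F : (ℕ → ℕ) → ℕ →. ℕ} (hF : IsTuringFunctional F) :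
      IsTuringFunctional fun X a =>
        Nat.rfind fun n => (fun m => m = 0) <$> F X (Nat.pair a n)

/-- A problem: instances, solutions, the relation "`Y` is a solution to `c`", and the coding of
instances and solutions by elements of `ℕ → ℕ`, through which functionals act on them. -/
structure Problem where
  Inst : Type
  Sol : Type
  IsSol : Inst → Sol → Prop
  instCode : Inst → ℕ → ℕ
  solCode : Sol → ℕ → ℕ

/-- `P` is strongly Weihrauch reducible to `Q`. -/
def StrongReducible (P Q : Problem) : Prop :=
  ∃ Φ Ψ : (ℕ → ℕ) → ℕ →. ℕ, IsTuringFunctional Φ ∧ IsTuringFunctional Ψ ∧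
    ∀ c : P.Inst, ∃ c' : Q.Inst,
      (∀ n, Φ (P.instCode c) n = Part.some (Q.instCode c' n)) ∧
      ∀ Y : Q.Sol, Q.IsSol c' Y → ∃ X : P.Sol,
        (∀ n, Ψ (Q.solCode Y) n = Part.some (P.solCode X n)) ∧ P.IsSol c X

/-- `P` and `Q` are strongly Weihrauch equivalent. -/
def StrongEquivalent (P Q : Problem) : Prop :=
  StrongReducible P Q ∧ StrongReducible Q P

/-- The `n`-element subsets of `ℕ`. -/
abbrev Subsets (n : ℕ) : Type := {s : Finset ℕ // s.card = n}

/-- The translate `{x + z : x ∈ s}`. -/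
def Subsets.shift {n : ℕ} (s : Subsets n) (z : ℕ) : Subsets n :=
  ⟨s.1.map (addRightEmbedding z), by rw [Finset.card_map]; exact s.2⟩

/-- `c(x + z) = c(x)` for all `n`-subsets `x` and all `z`. -/
def ZInvariant {n : ℕ} (c : Subsets n → ℕ) : Prop :=
  ∀ (s : Subsets n) (z : ℕ), c (s.shift z) = c s

/-- A colouring of `n`-subsets as an element of `ℕ → ℕ`: its value at the code of the increasing
list of the elements of `s` is `c s`, and its value at all other numbers is `0`. -/
def subsetColouringCode {n : ℕ} (c : Subsets n → ℕ) (m : ℕ) : ℕ :=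
  if h : (Denumerable.ofNat (List ℕ) m).Pairwise (· < ·) ∧
      (Denumerable.ofNat (List ℕ) m).length = n then
    c ⟨(Denumerable.ofNat (List ℕ) m).toFinset, by
      rw [List.toFinset_card_of_nodup (h.1.imp (fun hab => Nat.ne_of_lt hab))]; exact h.2⟩
  else 0

/-- A colouring of `d`-tuples as an element of `ℕ → ℕ`: its value at the code of the list
`x₁, …, x_d` is `c (x₁, …, x_d)`, and its value at all other numbers is `0`. -/
def tupleColouringCode {d : ℕ} (c : (Fin d → ℕ) → ℕ) (m : ℕ) : ℕ :=
  if h : (Denumerable.ofNat (List ℕ) m).length = d then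
    c fun i => (Denumerable.ofNat (List ℕ) m).get (i.cast h.symm)
  else 0

/-- The characteristic function of a set. -/
noncomputable def setCode (X : Set ℕ) : ℕ → ℕ := X.indicator 1

/-- The increasing enumeration of an infinite set. -/
noncomputable def enum (X : Set ℕ) : ℕ → ℕ := Nat.nth (· ∈ X)

/-- The least position of a nonzero binary digit of `x`, for `x ≠ 0`. -/
def lam (x : ℕ) : ℕ := padicValNat 2 x

/-- The largest position of a nonzero binary digit of `x`, for `x ≠ 0`. -/
def mu (x : ℕ) : ℕ := Nat.log 2 x

/-- The apartness condition. As `lam` and `mu` make sense for nonzero numbers only, the terms of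
the sequence are required to be nonzero. -/
def Apart (x : ℕ → ℕ) : Prop :=
  ∀ n, x n ≠ 0 ∧ mu (x n) < lam (x (n + 1))

/-- The separation condition for (the increasing enumeration of) a set. -/
def Separated (X : Set ℕ) : Prop :=
  ∀ n, mu (enum X (n + 1) - enum X n) < lam (enum X (n + 2) - enum X (n + 1))

/-- Adjacent `d`-tuples of adjacent sums of `x`. The summation ranges are the half-open intervals
`[k 0, k 1), [k 1, k 2), …, [k (d-1), k d)`. -/
def AFS (d : ℕ) (x : ℕ → ℕ) : Set (Fin d → ℕ) :=
  {v | ∃ k : Fin (d + 1) → ℕ, StrictMono k ∧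
    ∀ j : Fin d, v j = ∑ t ∈ Finset.Ico (k j.castSucc) (k j.succ), x t}

/-- The `ℤ`-Ramsey theorem for `n`-subsets with separation, as a problem. -/
noncomputable def sepZRT (n : ℕ) : Problem where
  Inst := {c : Subsets n → ℕ // (∃ k, ∀ s, c s < k) ∧ ZInvariant c}
  Sol := Set ℕ
  IsSol c X := X.Infinite ∧ Separated X ∧
    ∃ i, ∀ s : Subsets n, (s.1 : Set ℕ) ⊆ X → c.1 s = i
  instCode c := subsetColouringCode c.1
  solCode := setCode

/-- The `d`-dimensional adjacent Hindman theorem with apartness, as a problem. -/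
noncomputable def apAHT (d : ℕ) : Problem where
  Inst := {c : (Fin d → ℕ) → ℕ // ∃ k, ∀ v, c v < k}
  Sol := Set ℕ
  IsSol c Y := Y.Infinite ∧ Apart (enum Y) ∧
    ∃ i, ∀ v ∈ AFS d (enum Y), c.1 v = i
  instCode c := tupleColouringCode c.1
  solCode := setCode

end Weihrauch

/-! ## Models of `RCA₀`

A structure for the language of second-order arithmetic is a type `M` with `0, 1, +, *, <` (the
numbers, not necessarily standard) and a nonempty `S : Set (Set M)` (the sets). -/

namespace SecondOrderArith

/-- Adding a value for the variable `0` to an assignment, the other variables being shifted. -/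
def cons {M : Type u} (a : M) (v : ℕ → M) : ℕ → M
  | 0 => a
  | n + 1 => v n

/-- Numerical terms. -/
inductive Term : Type
  | var (n : ℕ)
  | zero
  | one
  | add (s t : Term)
  | mul (s t : Term)

/-- Bounded-quantifier formulas with number and set variables, with de Bruijn indices for number
variables: `ball t φ` is `∀ x < t, φ`, where `x` is the variable `0` of `φ`. -/
inductive BFormula : Type
  | eq (s t : Term)
  | lt (s t : Term)
  | mem (t : Term) (X : ℕ)
  | not (φ : BFormula)
  | and (φ ψ : BFormula)
  | ball (t : Term) (φ : BFormula)

section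

variable {M : Type u} [Zero M] [One M] [Add M] [Mul M] [LT M]

/-- The value of a term. -/
def Term.val (v : ℕ → M) : Term → M
  | var n => v n
  | zero => 0
  | one => 1
  | add s t => s.val v + t.val v
  | mul s t => s.val v * t.val v

/-- Truth of a bounded-quantifier formula, with set variables interpreted by `V`. -/
def BFormula.Holds (V : ℕ → Set M) : BFormula → (ℕ → M) → Prop
  | eq s t, v => s.val v = t.val v
  | lt s t, v => s.val v < t.val v
  | mem t X, v => t.val v ∈ V X
  | not φ, v => ¬ φ.Holds V v
  | and φ ψ, v => φ.Holds V v ∧ ψ.Holds V v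
  | ball t φ, v => ∀ a : M, a < t.val v → φ.Holds V (cons a v)

/-- `A` is defined by a `Σ⁰₁` formula with parameters from `M` and `S`. -/
def IsSigma1 (S : Set (Set M)) (A : Set M) : Prop :=
  ∃ (θ : BFormula) (V : ℕ → Set M) (v : ℕ → M), (∀ i, V i ∈ S) ∧
    ∀ a, a ∈ A ↔ ∃ b, θ.Holds V (cons b (cons a v))

/-- `A` is defined by a `Π⁰₁` formula with parameters from `M` and `S`. -/
def IsPi1 (S : Set (Set M)) (A : Set M) : Prop :=
  ∃ (θ : BFormula) (V : ℕ → Set M) (v : ℕ → M), (∀ i, V i ∈ S) ∧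
    ∀ a, a ∈ A ↔ ∀ b, θ.Holds V (cons b (cons a v))

/-- `(M, S)` is a model of `RCA₀`: the basic axioms, `Σ⁰₁` induction and `Δ⁰₁` comprehension. -/
structure IsModelRCA0 (S : Set (Set M)) : Prop where
  nonempty : S.Nonempty
  succ_ne_zero : ∀ m : M, m + 1 ≠ 0
  succ_inj : ∀ m n : M, m + 1 = n + 1 → m = n
  add_zero : ∀ m : M, m + 0 = m
  add_succ : ∀ m n : M, m + (n + 1) = (m + n) + 1
  mul_zero : ∀ m : M, m * 0 = 0
  mul_succ : ∀ m n : M, m * (n + 1) = m * n + m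
  not_lt_zero : ∀ m : M, ¬ m < 0
  lt_succ : ∀ m n : M, m < n + 1 ↔ (m < n ∨ m = n)
  induction : ∀ A : Set M, IsSigma1 S A → 0 ∈ A → (∀ a, a ∈ A → a + 1 ∈ A) → ∀ a, a ∈ A
  comprehension : ∀ A : Set M, IsSigma1 S A → IsPi1 S A → A ∈ S

/-- The usual pairing function of second-order arithmetic. -/
def pair (i j : M) : M := (i + j) * (i + j) + i

/-- Codes of tuples of a fixed standard length, by iterated pairing. -/
def tuple : {n : ℕ} → (Fin n → M) → M
  | 0, _ => 0
  | _ + 1, x => pair (x 0) (tuple fun i => x i.succ)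

/-- `x₁ < x₂ < ⋯ < xₙ`. -/
def Increasing {n : ℕ} (x : Fin n → M) : Prop := ∀ i j, i < j → x i < x j

/-- `C` is (the set of pairs coding) a function from the set `D` of `n`-tuples to
`{j : j < k}`. -/
def IsColouring {n : ℕ} (D : (Fin n → M) → Prop) (C : Set M) (k : M) : Prop :=
  (∀ w ∈ C, ∃ x j, D x ∧ j < k ∧ w = pair (tuple x) j) ∧
  ∀ x, D x → ∃! j, pair (tuple x) j ∈ C

/-- The colouring `C` of `n`-subsets (given as increasing `n`-tuples) is `ℤ`-invariant. -/
def ZInvariant (n : ℕ) (C : Set M) : Prop :=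
  ∀ x : Fin n → M, Increasing x → ∀ z j : M,
    pair (tuple x) j ∈ C ↔ pair (tuple fun i => x i + z) j ∈ C

/-- `X` is infinite, i.e. unbounded. -/
def Unbounded (X : Set M) : Prop := ∀ m, ∃ x ∈ X, m < x

/-- `a` and `b` are consecutive elements of `X` in its increasing enumeration. -/
def Consecutive (X : Set M) (a b : M) : Prop :=
  a ∈ X ∧ b ∈ X ∧ a < b ∧ ∀ c ∈ X, ¬ (a < c ∧ c < b)

/-- `f` is (the set of pairs coding) a function from numbers to numbers. -/
def IsFunction (f : Set M) : Prop :=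
  (∀ w ∈ f, ∃ n p, w = pair n p) ∧ ∀ n, ∃! p, pair n p ∈ f

/-- `E` is the function `n ↦ 2 ^ n`. -/
def IsExpTwo (E : Set M) : Prop :=
  IsFunction E ∧ pair 0 1 ∈ E ∧ ∀ n p, pair n p ∈ E → pair (n + 1) (p + p) ∈ E

/-- `μ(x) = m`, i.e. `2 ^ m ≤ x < 2 ^ (m + 1)`, where `E` is the function `n ↦ 2 ^ n`. -/
def IsMu (E : Set M) (x m : M) : Prop :=
  ∃ p q, pair m p ∈ E ∧ pair (m + 1) q ∈ E ∧ ¬ x < p ∧ x < q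

/-- `λ(x) = l`, i.e. `2 ^ l ∣ x` and `2 ^ (l + 1) ∤ x`, where `E` is the function `n ↦ 2 ^ n`. -/
def IsLam (E : Set M) (x l : M) : Prop :=
  ∃ p q, pair l p ∈ E ∧ pair (l + 1) q ∈ E ∧ (∃ t, x = p * t) ∧ ¬ ∃ t, x = q * t

/-- `μ(x) < λ(y)`; in particular `x` and `y` are nonzero. -/
def MuLtLam (S : Set (Set M)) (x y : M) : Prop :=
  ∃ E ∈ S, IsExpTwo E ∧ ∃ m l, IsMu E x m ∧ IsLam E y l ∧ m < l

/-- The apartness condition for (the increasing enumeration of) `Y`. -/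
def Apart (S : Set (Set M)) (Y : Set M) : Prop :=
  ∀ a b, Consecutive Y a b → MuLtLam S a b

/-- The separation condition for (the increasing enumeration of) `X`. -/
def Separated (S : Set (Set M)) (X : Set M) : Prop :=
  ∀ a b c, Consecutive X a b → Consecutive X b c →
    ∃ p q, b = a + p ∧ c = b + q ∧ MuLtLam S p q

/-- `s` is the function whose value at `m` is the sum of all elements of `Y` below `m`. -/
def IsSumFunction (Y s : Set M) : Prop :=
  IsFunction s ∧ pair 0 0 ∈ s ∧
    ∀ m p, pair m p ∈ s →
      (m ∈ Y → pair (m + 1) (p + m) ∈ s) ∧ (m ∉ Y → pair (m + 1) p ∈ s)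

/-- `z` is an adjacent `d`-tuple of adjacent sums of the infinite set `Y`: for some elements
`m₀ < m₁ < ⋯ < m_d` of `Y`, the `j`-th entry is the sum of all `y ∈ Y` with
`m_{j-1} ≤ y < m_j`, where `s` is the sum function of `Y`. -/
def IsAFS (d : ℕ) (Y s : Set M) (z : Fin d → M) : Prop :=
  ∃ m : Fin (d + 1) → M, Increasing m ∧ (∀ i, m i ∈ Y) ∧
    ∀ j : Fin d, ∃ p, pair (m j.castSucc) p ∈ s ∧ pair (m j.succ) (p + z j) ∈ s

/-- `(M, S)` satisfies the `ℤ`-Ramsey theorem for `n`-subsets with separation. -/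
def SatSepZRT (n : ℕ) (S : Set (Set M)) : Prop :=
  ∀ k : M, ∀ C ∈ S, IsColouring (fun x : Fin n → M => Increasing x) C k → ZInvariant n C →
    ∃ X ∈ S, Unbounded X ∧ Separated S X ∧
      ∃ i, ∀ x : Fin n → M, Increasing x → (∀ j, x j ∈ X) → pair (tuple x) i ∈ C

/-- `(M, S)` satisfies the `d`-dimensional adjacent Hindman theorem with apartness. -/
def SatApAHT (d : ℕ) (S : Set (Set M)) : Prop :=
  ∀ k : M, ∀ C ∈ S, IsColouring (fun _ : Fin d → M => True) C k →
    ∃ Y ∈ S, Unbounded Y ∧ Apart S Y ∧ ∃ s ∈ S, IsSumFunction Y s ∧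
      ∃ i, ∀ z : Fin d → M, IsAFS d Y s z → pair (tuple z) i ∈ C

end

end SecondOrderArith

/-!
A tuple of positive numbers is, up to translation, the same thing as a finite set: take the partial
sums in one direction and the successive differences in the other. So a `ℤ`-invariant colouring of
`d + 1`-sets is essentially a colouring of `d`-tuples. On the side of solutions, the set of the sums
of the initial segments of `Y` has the elements of `Y` as its gaps, and separation of a set is
apartness of its set of gaps; the differences of a `d + 1`-tuple from the set are then an adjacent
`d`-tuple of sums from `Y`.

That the gaps of a separated set `X` form a computable, or `Δ⁰₁`, set is due to their being
increasing: whether `n` is a gap is known as soon as a gap longer than `n` has been found. In a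
model of `RCA₀`, the sum function of the set of gaps is obtained without coding a recursion, since
the sum of the gaps below `m` is the distance from the least element of `X` to the first `a ∈ X`
whose gap is at least `m`.
-/

/-! ### Definability by bounded formulas with parameters -/

namespace SecondOrderArith

/-- The extension of a renaming `ρ` of variables to formulas under one more quantifier. -/
def liftVar (ρ : ℕ → ℕ) : ℕ → ℕ
  | 0 => 0
  | n + 1 => ρ n + 1

/-- Renaming of variables in a term. -/
def Term.rename (ρ : ℕ → ℕ) : Term → Term
  | var n => var (ρ n)
  | zero => zero
  | one => one
  | add s t => add (s.rename ρ) (t.rename ρ)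
  | mul s t => mul (s.rename ρ) (t.rename ρ)

/-- Renaming of set variables by `σ` and of free number variables by `ρ` in a formula. -/
def BFormula.rename (σ : ℕ → ℕ) : (ℕ → ℕ) → BFormula → BFormula
  | ρ, eq s t => eq (s.rename ρ) (t.rename ρ)
  | ρ, lt s t => lt (s.rename ρ) (t.rename ρ)
  | ρ, mem t X => mem (t.rename ρ) (σ X)
  | ρ, not φ => not (φ.rename σ ρ)
  | ρ, and φ ψ => and (φ.rename σ ρ) (ψ.rename σ ρ)
  | ρ, ball t φ => ball (t.rename ρ) (φ.rename σ (liftVar ρ))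

theorem cons_comp_liftVar {M : Type*} (a : M) (v : ℕ → M) (ρ : ℕ → ℕ) :
    cons a v ∘ liftVar ρ = cons a (v ∘ ρ) :=
  funext fun
    | 0 => rfl
    | _ + 1 => rfl

section Definability

variable {M : Type*} [Add M] [Mul M]

theorem Term.val_rename [Zero M] [One M] (ρ : ℕ → ℕ) (v : ℕ → M) (τ : Term) :
    (τ.rename ρ).val v = τ.val (v ∘ ρ) := by
  induction τ with
  | var | zero | one => rfl
  | add _ _ hs ht | mul _ _ hs ht => simp only [rename, val, hs, ht]

theorem BFormula.holds_rename [Zero M] [One M] [LT M] (σ ρ : ℕ → ℕ) (V : ℕ → Set M) (v : ℕ → M)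
    (θ : BFormula) :
    (θ.rename σ ρ).Holds V v ↔ θ.Holds (V ∘ σ) (v ∘ ρ) := by
  induction θ generalizing ρ v with
  | eq | lt | mem => simp only [rename, Holds, Term.val_rename, Function.comp_apply]
  | not _ h => simp only [rename, Holds, h]
  | and _ _ h₁ h₂ => simp only [rename, Holds, h₁, h₂]
  | ball _ _ h => simp only [rename, Holds, Term.val_rename, h, cons_comp_liftVar]

/-- The functions of a tuple `x : ι → M` given by terms in the coordinates of `x` and in
parameters from `M`. -/
inductive TermDef {ι : Type} : ((ι → M) → M) → Prop
  | var (i : ι) : TermDef fun x => x i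
  | const (c : M) : TermDef fun _ => c
  | add {s t : (ι → M) → M} (hs : TermDef s) (ht : TermDef t) : TermDef fun x => s x + t x
  | mul {s t : (ι → M) → M} (hs : TermDef s) (ht : TermDef t) : TermDef fun x => s x * t x

namespace TermDef

variable {ι κ : Type} {s t : (ι → M) → M}

theorem pair (hs : TermDef s) (ht : TermDef t) : TermDef fun x => pair (s x) (t x) :=
  ((hs.add ht).mul (hs.add ht)).add hs

theorem tuple [Zero M] {n : ℕ} {y : Fin n → (ι → M) → M} (hy : ∀ i, TermDef (y i)) :
    TermDef fun x => tuple fun i => y i x := by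
  induction n with
  | zero => exact .const 0
  | succ n ih => exact (hy 0).pair (ih fun i => hy i.succ)

theorem reindex (f : ι → κ) (ht : TermDef t) : TermDef fun x : κ → M => t (x ∘ f) := by
  induction ht with
  | var i => exact .var (f i)
  | const c => exact .const c
  | add _ _ hs ht => exact hs.add ht
  | mul _ _ hs ht => exact hs.mul ht

end TermDef

variable [LT M] {S : Set (Set M)}

/-- The predicates on tuples `x : ι → M` given by bounded formulas in the coordinates of `x`, with
number parameters from `M` and set parameters from `S`. In the scope of a quantifier the tuple is
indexed by `Option ι`, with `none` for the quantified variable. -/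
inductive BoundedDef (S : Set (Set M)) : ∀ {ι : Type}, ((ι → M) → Prop) → Prop
  | eq {ι : Type} {s t : (ι → M) → M} (hs : TermDef s) (ht : TermDef t) :
      BoundedDef S fun x => s x = t x
  | lt {ι : Type} {s t : (ι → M) → M} (hs : TermDef s) (ht : TermDef t) :
      BoundedDef S fun x => s x < t x
  | mem {ι : Type} {t : (ι → M) → M} {A : Set M} (ht : TermDef t) (hA : A ∈ S) :
      BoundedDef S fun x => t x ∈ A
  | not {ι : Type} {P : (ι → M) → Prop} (hP : BoundedDef S P) : BoundedDef S fun x => ¬ P x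
  | and {ι : Type} {P Q : (ι → M) → Prop} (hP : BoundedDef S P) (hQ : BoundedDef S Q) :
      BoundedDef S fun x => P x ∧ Q x
  | ball {ι : Type} {t : (ι → M) → M} {P : M → (ι → M) → Prop} (ht : TermDef t)
      (hP : BoundedDef S fun y : Option ι → M => P (y none) (y ∘ some)) :
      BoundedDef S fun x => ∀ a, a < t x → P a x

namespace BoundedDef

variable {ι κ : Type} {t : (ι → M) → M} {P Q : (ι → M) → Prop}

theorem congr (hP : BoundedDef S P) (h : ∀ x, P x ↔ Q x) : BoundedDef S Q :=
  (funext fun x => propext (h x) : P = Q) ▸ hP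

theorem or (hP : BoundedDef S P) (hQ : BoundedDef S Q) : BoundedDef S fun x => P x ∨ Q x :=
  (hP.not.and hQ.not).not.congr fun _ => by tauto

theorem imp (hP : BoundedDef S P) (hQ : BoundedDef S Q) : BoundedDef S fun x => P x → Q x :=
  (hP.and hQ.not).not.congr fun _ => by tauto

theorem bex {P : M → (ι → M) → Prop} (ht : TermDef t)
    (hP : BoundedDef S fun y : Option ι → M => P (y none) (y ∘ some)) :
    BoundedDef S fun x => ∃ a, a < t x ∧ P a x :=
  (ball (P := fun a x => ¬ P a x) ht hP.not).not.congr fun x => by push Not; rfl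

theorem reindex (hP : BoundedDef S P) (f : ι → κ) : BoundedDef S fun x : κ → M => P (x ∘ f) := by
  induction hP generalizing κ with
  | eq hs ht => exact .eq (hs.reindex f) (ht.reindex f)
  | lt hs ht => exact .lt (hs.reindex f) (ht.reindex f)
  | mem ht hA => exact .mem (ht.reindex f) hA
  | not _ ih => exact (ih f).not
  | and _ _ ihP ihQ => exact (ihP f).and (ihQ f)
  | ball ht _ ih => exact .ball (ht.reindex f) (ih (Option.map f))

theorem forall_fin [Zero M] {n : ℕ} {P : Fin n → (ι → M) → Prop} (h : ∀ i, BoundedDef S (P i)) :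
    BoundedDef S fun x => ∀ i, P i x := by
  induction n with
  | zero => exact (eq (.const 0) (.const 0)).congr fun x => by simp
  | succ n ih =>
    exact ((h 0).and (ih fun i => h i.succ)).congr fun x => by rw [Fin.forall_fin_succ]

theorem bex_fin {n : ℕ} {P : (Fin n → M) → (ι → M) → Prop} (ht : TermDef t)
    (h : BoundedDef S fun y : Fin n ⊕ ι → M => P (y ∘ Sum.inl) (y ∘ Sum.inr)) :
    BoundedDef S fun x => ∃ z : Fin n → M, (∀ i, z i < t x) ∧ P z x := by
  induction n generalizing ι with
  | zero =>
    refine (h.reindex (Sum.elim Fin.elim0 id)).congr fun x => ⟨fun hP => ⟨_, nofun, hP⟩, ?_⟩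
    rintro ⟨z, -, hP⟩
    rwa [Subsingleton.elim (_ ∘ Sum.inl) z]
  | succ n ih =>
    have key : BoundedDef S fun y : Option ι → M => ∃ z : Fin n → M,
        (∀ i, z i < t (y ∘ some)) ∧ P (Fin.cons (y none) z) (y ∘ some) := by
      refine ih (P := fun z y => P (Fin.cons (y none) z) (y ∘ some)) (ht.reindex some) <|
        (h.reindex (Sum.elim (Fin.cons (.inr none) .inl) (.inr ∘ some))).congr fun y => ?_
      refine iff_of_eq (congrArg (P · _) (funext fun i => ?_))
      cases i using Fin.cases <;> rfl
    refine (bex (P := fun a x => ∃ z : Fin n → M, (∀ i, z i < t x) ∧ P (Fin.cons a z) x)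
      ht key).congr fun x => ⟨?_, ?_⟩
    · rintro ⟨a, ha, z, hz, hP⟩
      exact ⟨Fin.cons a z, Fin.forall_fin_succ.2 ⟨ha, hz⟩, hP⟩
    · rintro ⟨z, hz, hP⟩
      exact ⟨z 0, hz 0, Fin.tail z, fun i => hz i.succ, by rwa [Fin.cons_self_tail]⟩

end BoundedDef

end Definability

section Realization

/-- The values of number variables, each of which is either a coordinate of `x` or a fixed
parameter, as told by `e`. -/
def assignment {M ι : Type*} (e : ℕ → ι ⊕ M) (x : ι → M) : ℕ → M := fun i => (e i).elim x id

theorem exists_common_extension {α : Type*} (f g : ℕ → α) :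
    ∃ (h : ℕ → α) (ρ σ : ℕ → ℕ), h ∘ ρ = f ∧ h ∘ σ = g ∧
      Set.range h = Set.range f ∪ Set.range g := by
  refine ⟨Sum.elim f g ∘ Equiv.natSumNatEquivNat.symm, Equiv.natSumNatEquivNat ∘ .inl,
    Equiv.natSumNatEquivNat ∘ .inr, ?_, ?_, ?_⟩
  · ext; simp
  · ext; simp
  · rw [EquivLike.range_comp, Set.Sum.elim_range]

theorem exists_cons_comp_eq_assignment {M ι : Type*} (c : M) (e : ℕ → Option ι ⊕ M) :
    ∃ (ρ : ℕ → ℕ) (f : ℕ → ι ⊕ M), ∀ (a : M) (x : ι → M),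
      cons a (assignment f x) ∘ ρ = assignment e (fun o => o.elim a x) := by
  refine ⟨fun i => (e i).elim (fun o => o.elim 0 fun _ => i + 1) fun _ => i + 1,
    fun i => (e i).elim (fun o => o.elim (.inr c) .inl) .inr, fun a x => funext fun i => ?_⟩
  rcases h : e i with (_ | _) | _ <;> simp [h, cons, assignment]

variable {M : Type*} [Zero M] [One M] [Add M] [Mul M] {ι : Type}

theorem TermDef.exists_common_assignment {s t : (ι → M) → M}
    (hs : ∃ (σ : Term) (e : ℕ → ι ⊕ M), ∀ x, σ.val (assignment e x) = s x)
    (ht : ∃ (τ : Term) (e : ℕ → ι ⊕ M), ∀ x, τ.val (assignment e x) = t x) :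
    ∃ (σ τ : Term) (e : ℕ → ι ⊕ M),
      (∀ x, σ.val (assignment e x) = s x) ∧ ∀ x, τ.val (assignment e x) = t x := by
  obtain ⟨σ, e, hσ⟩ := hs
  obtain ⟨τ, f, hτ⟩ := ht
  obtain ⟨g, ρ₁, ρ₂, rfl, rfl, -⟩ := exists_common_extension e f
  exact ⟨σ.rename ρ₁, τ.rename ρ₂, g, fun x => (σ.val_rename _ _).trans (hσ x),
    fun x => (τ.val_rename _ _).trans (hτ x)⟩

theorem TermDef.exists_term {t : (ι → M) → M} (ht : TermDef t) :
    ∃ (τ : Term) (e : ℕ → ι ⊕ M), ∀ x, τ.val (assignment e x) = t x := by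
  induction ht with
  | var i => exact ⟨.var 0, fun _ => .inl i, fun _ => rfl⟩
  | const c => exact ⟨.var 0, fun _ => .inr c, fun _ => rfl⟩
  | add _ _ hs ht =>
    obtain ⟨σ, τ, e, hσ, hτ⟩ := exists_common_assignment hs ht
    exact ⟨.add σ τ, e, fun x => congrArg₂ (· + ·) (hσ x) (hτ x)⟩
  | mul _ _ hs ht =>
    obtain ⟨σ, τ, e, hσ, hτ⟩ := exists_common_assignment hs ht
    exact ⟨.mul σ τ, e, fun x => congrArg₂ (· * ·) (hσ x) (hτ x)⟩

variable [LT M] {S : Set (Set M)}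

theorem BoundedDef.exists_formula {P : (ι → M) → Prop} (hP : BoundedDef S P) (hS : S.Nonempty) :
    ∃ (θ : BFormula) (V : ℕ → Set M) (e : ℕ → ι ⊕ M), (∀ i, V i ∈ S) ∧
      ∀ x, θ.Holds V (assignment e x) ↔ P x := by
  obtain ⟨A₀, hA₀⟩ := hS
  induction hP with
  | eq hs ht =>
    obtain ⟨σ, τ, e, hσ, hτ⟩ := TermDef.exists_common_assignment hs.exists_term ht.exists_term
    exact ⟨.eq σ τ, fun _ => A₀, e, fun _ => hA₀,
      fun x => iff_of_eq (congrArg₂ (· = ·) (hσ x) (hτ x))⟩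
  | lt hs ht =>
    obtain ⟨σ, τ, e, hσ, hτ⟩ := TermDef.exists_common_assignment hs.exists_term ht.exists_term
    exact ⟨.lt σ τ, fun _ => A₀, e, fun _ => hA₀,
      fun x => iff_of_eq (congrArg₂ (· < ·) (hσ x) (hτ x))⟩
  | @mem _ _ A ht hA =>
    obtain ⟨τ, e, hτ⟩ := ht.exists_term
    exact ⟨.mem τ 0, fun _ => A, e, fun _ => hA, fun x => iff_of_eq (congrArg (· ∈ A) (hτ x))⟩
  | not _ ih =>
    obtain ⟨θ, V, e, hV, hθ⟩ := ih
    exact ⟨.not θ, V, e, hV, fun x => not_congr (hθ x)⟩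
  | and _ _ ihP ihQ =>
    obtain ⟨θ, V, e, hV, hθ⟩ := ihP
    obtain ⟨η, W, f, hW, hη⟩ := ihQ
    obtain ⟨g, ρ₁, ρ₂, rfl, rfl, -⟩ := exists_common_extension e f
    obtain ⟨U, σ₁, σ₂, rfl, rfl, hU⟩ := exists_common_extension V W
    refine ⟨.and (θ.rename σ₁ ρ₁) (η.rename σ₂ ρ₂), U, g, ?_, fun x => ?_⟩
    · exact Set.range_subset_iff.1 <| hU.trans_subset <|
        Set.union_subset (Set.range_subset_iff.2 hV) (Set.range_subset_iff.2 hW)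
    · exact and_congr ((θ.holds_rename _ _ _ _).trans (hθ x))
        ((η.holds_rename _ _ _ _).trans (hη x))
  | ball ht _ ih =>
    obtain ⟨θ, V, e, hV, hθ⟩ := ih
    obtain ⟨τ, f, hτ⟩ := ht.exists_term
    obtain ⟨ρ, e', he'⟩ := exists_cons_comp_eq_assignment 0 e
    obtain ⟨g, ρ₁, ρ₂, rfl, rfl, -⟩ := exists_common_extension f e'
    refine ⟨.ball (τ.rename ρ₁) (θ.rename id (liftVar ρ₂ ∘ ρ)), V, g, hV, fun x => ?_⟩
    have hτ' : (τ.rename ρ₁).val (assignment g x) = _ := (τ.val_rename _ _).trans (hτ x)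
    rw [BFormula.Holds, hτ']
    refine forall₂_congr fun a _ => ?_
    rw [BFormula.holds_rename, ← Function.comp_assoc, cons_comp_liftVar]
    exact (iff_of_eq (congrArg _ (he' a x))).trans (hθ _)

theorem BoundedDef.exists_formula_cons_cons {P : M → M → Prop}
    (hP : BoundedDef S fun x : Fin 2 → M => P (x 0) (x 1)) (hS : S.Nonempty) :
    ∃ (θ : BFormula) (V : ℕ → Set M) (v : ℕ → M), (∀ i, V i ∈ S) ∧
      ∀ a b, θ.Holds V (cons b (cons a v)) ↔ P a b := by
  obtain ⟨θ, V, e, hV, hθ⟩ := hP.exists_formula hS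
  let ρ : ℕ → ℕ := fun i => (e i).elim ![1, 0] fun _ => i + 2
  let v : ℕ → M := fun i => (e i).elim (fun _ => 0) id
  have hρ (a b : M) : cons b (cons a v) ∘ ρ = assignment e ![a, b] := by
    funext i
    rcases h : e i with j | c
    · fin_cases j <;> simp [ρ, h, cons, assignment]
    · simp [ρ, v, h, cons, assignment]
  refine ⟨θ.rename id ρ, V, v, hV, fun a b => ?_⟩
  rw [BFormula.holds_rename, hρ]
  exact hθ _

namespace IsModelRCA0

theorem induction_exists (hS : IsModelRCA0 S) {P : M → M → Prop}
    (hP : BoundedDef S fun x : Fin 2 → M => P (x 0) (x 1)) (zero : ∃ b, P 0 b)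
    (succ : ∀ a, (∃ b, P a b) → ∃ b, P (a + 1) b) (a : M) : ∃ b, P a b := by
  obtain ⟨θ, V, v, hV, hθ⟩ := hP.exists_formula_cons_cons hS.nonempty
  exact hS.induction {a | ∃ b, P a b} ⟨θ, V, v, hV, fun a => exists_congr fun b => (hθ a b).symm⟩
    zero succ a

theorem induction_bounded (hS : IsModelRCA0 S) {P : M → Prop}
    (hP : BoundedDef S fun x : Fin 1 → M => P (x 0)) (zero : P 0)
    (succ : ∀ a, P a → P (a + 1)) (a : M) : P a :=
  (hS.induction_exists (P := fun a _ => P a) (hP.reindex ![0]) ⟨0, zero⟩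
    (fun a ⟨_, h⟩ => ⟨0, succ a h⟩) a).elim fun _ h => h

theorem setOf_mem_of_iff (hS : IsModelRCA0 S) {P Q : M → M → Prop}
    (hP : BoundedDef S fun x : Fin 2 → M => P (x 0) (x 1))
    (hQ : BoundedDef S fun x : Fin 2 → M => Q (x 0) (x 1))
    (hPQ : ∀ a, (∃ b, P a b) ↔ ∀ b, Q a b) : {a | ∃ b, P a b} ∈ S := by
  obtain ⟨θ, V, v, hV, hθ⟩ := hP.exists_formula_cons_cons hS.nonempty
  obtain ⟨η, W, w, hW, hη⟩ := hQ.exists_formula_cons_cons hS.nonempty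
  exact hS.comprehension _
    ⟨θ, V, v, hV, fun a => exists_congr fun b => (hθ a b).symm⟩
    ⟨η, W, w, hW, fun a => (hPQ a).trans (forall_congr' fun b => (hη a b).symm)⟩

theorem setOf_mem (hS : IsModelRCA0 S) {P : M → Prop}
    (hP : BoundedDef S fun x : Fin 1 → M => P (x 0)) : {a | P a} ∈ S := by
  have := hS.setOf_mem_of_iff (P := fun a _ => P a) (Q := fun a _ => P a) (hP.reindex ![0])
    (hP.reindex ![0]) fun a => by simp
  simpa using this

end IsModelRCA0

end Realization

end SecondOrderArith

/-! ### Arithmetic in models of `RCA₀` -/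

/-- Commutative semirings that are linearly ordered by `a ≤ b ↔ ∃ c, b = a + c` and in which
`a + 1` is the successor of `a`: the models of `PA⁻`. -/
class DiscreteOrderedSemiring (M : Type*) extends CommSemiring M, LinearOrder M,
  IsStrictOrderedRing M, CanonicallyOrderedAdd M, SuccAddOrder M

namespace SecondOrderArith.IsModelRCA0

variable {M : Type*} [Zero M] [One M] [Add M] [Mul M] [LT M] {S : Set (Set M)}

protected theorem zero_add (hS : IsModelRCA0 S) (a : M) : 0 + a = a :=
  hS.induction_bounded (P := fun a => 0 + a = a) (.eq (.add (.const 0) (.var 0)) (.var 0))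
    (hS.add_zero 0) (fun a h => by rw [hS.add_succ, h]) a

protected theorem add_assoc (hS : IsModelRCA0 S) (a b c : M) : a + b + c = a + (b + c) := by
  refine hS.induction_bounded (P := fun c => a + b + c = a + (b + c))
    (.eq (.add (.const _) (.var 0)) (.add (.const _) (.add (.const _) (.var 0)))) ?_ ?_ c
  · rw [hS.add_zero, hS.add_zero]
  · intro c h
    rw [hS.add_succ, h, hS.add_succ, hS.add_succ]

protected theorem succ_add (hS : IsModelRCA0 S) (a b : M) : a + 1 + b = a + b + 1 := by
  refine hS.induction_bounded (P := fun b => a + 1 + b = a + b + 1)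
    (.eq (.add (.const _) (.var 0)) (.add (.add (.const _) (.var 0)) (.const 1))) ?_ ?_ b
  · rw [hS.add_zero, hS.add_zero]
  · intro b h
    rw [hS.add_succ, h, hS.add_succ]

protected theorem add_comm (hS : IsModelRCA0 S) (a b : M) : a + b = b + a := by
  refine hS.induction_bounded (P := fun b => a + b = b + a)
    (.eq (.add (.const _) (.var 0)) (.add (.var 0) (.const _))) ?_ ?_ b
  · rw [hS.add_zero, hS.zero_add]
  · intro b h
    rw [hS.add_succ, h, hS.succ_add]

protected theorem add_right_comm (hS : IsModelRCA0 S) (a b c : M) : a + b + c = a + c + b := by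
  rw [hS.add_assoc, hS.add_comm b c, hS.add_assoc]

protected theorem add_left_cancel (hS : IsModelRCA0 S) {a b c : M} (h : c + a = c + b) :
    a = b := by
  rw [hS.add_comm c, hS.add_comm c] at h
  refine hS.induction_bounded (P := fun c => a + c = b + c → a = b)
    (.imp (.eq (.add (.const _) (.var 0)) (.add (.const _) (.var 0))) (.eq (.const _) (.const _)))
    ?_ ?_ c h
  · simp only [hS.add_zero, imp_self]
  · intro c ih h
    rw [hS.add_succ, hS.add_succ] at h
    exact ih (hS.succ_inj _ _ h)

protected theorem zero_mul (hS : IsModelRCA0 S) (a : M) : 0 * a = 0 :=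
  hS.induction_bounded (P := fun a => 0 * a = 0) (.eq (.mul (.const 0) (.var 0)) (.const 0))
    (hS.mul_zero 0) (fun a h => by rw [hS.mul_succ, h, hS.add_zero]) a

protected theorem succ_mul (hS : IsModelRCA0 S) (a b : M) : (a + 1) * b = a * b + b := by
  refine hS.induction_bounded (P := fun b => (a + 1) * b = a * b + b)
    (.eq (.mul (.const _) (.var 0)) (.add (.mul (.const _) (.var 0)) (.var 0))) ?_ ?_ b
  · rw [hS.mul_zero, hS.mul_zero, hS.add_zero]
  · intro b h
    rw [hS.mul_succ, h, hS.mul_succ, hS.add_succ, hS.add_succ, hS.add_right_comm (a * b)]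

protected theorem mul_comm (hS : IsModelRCA0 S) (a b : M) : a * b = b * a := by
  refine hS.induction_bounded (P := fun b => a * b = b * a)
    (.eq (.mul (.const _) (.var 0)) (.mul (.var 0) (.const _))) ?_ ?_ b
  · rw [hS.mul_zero, hS.zero_mul]
  · intro b h
    rw [hS.mul_succ, h, hS.succ_mul]

protected theorem mul_add (hS : IsModelRCA0 S) (a b c : M) : a * (b + c) = a * b + a * c := by
  refine hS.induction_bounded (P := fun c => a * (b + c) = a * b + a * c)
    (.eq (.mul (.const _) (.add (.const _) (.var 0)))
      (.add (.const _) (.mul (.const _) (.var 0)))) ?_ ?_ c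
  · rw [hS.mul_zero, hS.add_zero, hS.add_zero]
  · intro c h
    rw [hS.add_succ, hS.mul_succ, h, hS.mul_succ, hS.add_assoc]

protected theorem mul_assoc (hS : IsModelRCA0 S) (a b c : M) : a * b * c = a * (b * c) := by
  refine hS.induction_bounded (P := fun c => a * b * c = a * (b * c))
    (.eq (.mul (.const _) (.var 0)) (.mul (.const _) (.mul (.const _) (.var 0)))) ?_ ?_ c
  · rw [hS.mul_zero, hS.mul_zero, hS.mul_zero]
  · intro c h
    rw [hS.mul_succ, h, hS.mul_succ, hS.mul_add]

protected theorem mul_one (hS : IsModelRCA0 S) (a : M) : a * 1 = a := by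
  rw [← hS.zero_add 1, hS.mul_succ, hS.mul_zero, hS.zero_add]

theorem eq_zero_or_succ (hS : IsModelRCA0 S) (a : M) : a = 0 ∨ ∃ b, a = b + 1 := by
  obtain ⟨b, h⟩ := hS.induction_exists (P := fun a b => a = 0 ∨ a = b + 1)
    (.or (.eq (.var 0) (.const 0)) (.eq (.var 0) (.add (.var 1) (.const 1))))
    ⟨0, .inl rfl⟩ (fun a _ => ⟨a, .inr rfl⟩) a
  exact h.imp_right fun h => ⟨b, h⟩

theorem eq_zero_of_add_eq_zero (hS : IsModelRCA0 S) {a b : M} (h : a + b = 0) : b = 0 := by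
  obtain rfl | ⟨b, rfl⟩ := hS.eq_zero_or_succ b
  · rfl
  · rw [hS.add_succ] at h
    exact absurd h (hS.succ_ne_zero _)

theorem eq_zero_of_add_eq_self (hS : IsModelRCA0 S) {a b : M} (h : a + b = a) : b = 0 :=
  hS.add_left_cancel (h.trans (hS.add_zero a).symm)

theorem lt_add_succ (hS : IsModelRCA0 S) (a c : M) : a < a + (c + 1) := by
  refine hS.induction_bounded (P := fun c => a < a + (c + 1))
    (.lt (.const _) (.add (.const _) (.add (.var 0) (.const 1)))) ?_ (fun c h => ?_) c
  · rw [hS.add_succ, hS.add_zero, hS.lt_succ]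
    exact .inr rfl
  · rw [hS.add_succ, hS.lt_succ]
    exact .inl h

theorem lt_iff_exists (hS : IsModelRCA0 S) (a b : M) : a < b ↔ ∃ c, b = a + (c + 1) := by
  refine ⟨fun hab => ?_, fun ⟨c, hc⟩ => hc ▸ hS.lt_add_succ a c⟩
  obtain ⟨c, h⟩ := hS.induction_exists (P := fun b c => a < b → b = a + (c + 1))
    (.imp (.lt (.const _) (.var 0)) (.eq (.var 0) (.add (.const _) (.add (.var 1) (.const 1)))))
    ⟨0, fun h => absurd h (hS.not_lt_zero _)⟩ (fun b ⟨c, hc⟩ => by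
      by_cases hab : a < b
      · exact ⟨c + 1, fun _ => by rw [hc hab, ← hS.add_succ]⟩
      · refine ⟨0, fun h => ?_⟩
        rw [hS.zero_add, ((hS.lt_succ _ _).1 h).resolve_left hab]) b
  exact ⟨c, h hab⟩

theorem exists_eq_add_or_eq_add (hS : IsModelRCA0 S) (a b : M) : ∃ c, b = a + c ∨ a = b + c := by
  refine hS.induction_exists (P := fun a c => b = a + c ∨ a = b + c)
    (.or (.eq (.const _) (.add (.var 0) (.var 1))) (.eq (.var 0) (.add (.const _) (.var 1))))
    ⟨b, .inl (hS.zero_add b).symm⟩ ?_ a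
  rintro a ⟨c, h | h⟩
  · obtain rfl | ⟨c, rfl⟩ := hS.eq_zero_or_succ c
    · exact ⟨1, .inr (by rw [h, hS.add_zero])⟩
    · exact ⟨c, .inl (by rw [hS.succ_add, ← hS.add_succ, h])⟩
  · exact ⟨c + 1, .inr (by rw [hS.add_succ, h])⟩

/-- The semiring of numbers of a model. -/
abbrev commSemiring (hS : IsModelRCA0 S) : CommSemiring M where
  add_assoc := hS.add_assoc
  zero_add := hS.zero_add
  add_zero := hS.add_zero
  add_comm := hS.add_comm
  nsmul := nsmulRec
  left_distrib := hS.mul_add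
  right_distrib a b c := by rw [hS.mul_comm, hS.mul_add, hS.mul_comm c, hS.mul_comm c]
  zero_mul := hS.zero_mul
  mul_zero := hS.mul_zero
  mul_assoc := hS.mul_assoc
  one_mul a := by rw [hS.mul_comm, hS.mul_one]
  mul_one := hS.mul_one
  mul_comm := hS.mul_comm

/-- The order of the numbers of a model. -/
noncomputable abbrev linearOrder (hS : IsModelRCA0 S) : LinearOrder M where
  le a b := ∃ c, b = a + c
  le_refl a := ⟨0, (hS.add_zero a).symm⟩
  le_trans := by
    rintro a _ _ ⟨c, rfl⟩ ⟨e, rfl⟩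
    exact ⟨c + e, hS.add_assoc _ _ _⟩
  lt_iff_le_not_ge a b := by
    rw [hS.lt_iff_exists]
    constructor
    · rintro ⟨c, rfl⟩
      refine ⟨⟨_, rfl⟩, fun ⟨e, he⟩ => hS.succ_ne_zero c ?_⟩
      rw [hS.add_assoc, hS.add_comm _ e] at he
      exact hS.eq_zero_of_add_eq_zero (hS.eq_zero_of_add_eq_self he.symm)
    · rintro ⟨⟨c, rfl⟩, h⟩
      obtain rfl | ⟨c, rfl⟩ := hS.eq_zero_or_succ c
      · exact absurd ⟨0, by rw [hS.add_zero, hS.add_zero]⟩ h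
      · exact ⟨c, rfl⟩
  le_antisymm := by
    rintro a _ ⟨c, rfl⟩ ⟨e, he⟩
    rw [hS.add_assoc, hS.add_comm c] at he
    rw [hS.eq_zero_of_add_eq_zero (hS.eq_zero_of_add_eq_self he.symm), hS.add_zero]
  le_total a b := by
    obtain ⟨c, h | h⟩ := hS.exists_eq_add_or_eq_add a b
    · exact .inl ⟨c, h⟩
    · exact .inr ⟨c, h⟩
  toDecidableLE := Classical.decRel _

protected theorem mul_lt_mul_of_pos_left (hS : IsModelRCA0 S) {a b c : M} (ha : 0 < a)
    (hbc : b < c) :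
    a * b < a * c := by
  obtain ⟨e, rfl⟩ := (hS.lt_iff_exists _ _).1 hbc
  obtain ⟨f, hf⟩ := (hS.lt_iff_exists _ _).1 ha
  rw [hS.zero_add] at hf
  refine (hS.lt_iff_exists _ _).2 ⟨a * e + f, ?_⟩
  rw [hS.mul_add, hS.mul_succ, hS.add_assoc, ← hf]

/-- The numbers of a model as a model of `PA⁻`. -/
noncomputable abbrev discreteOrderedSemiring (hS : IsModelRCA0 S) : DiscreteOrderedSemiring M :=
  letI := hS.commSemiring
  letI := hS.linearOrder
  { hS.commSemiring, hS.linearOrder with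
    add_le_add_left := by
      rintro a _ ⟨e, rfl⟩ c
      exact ⟨e, hS.add_right_comm _ _ _⟩
    le_of_add_le_add_left := fun a b c ⟨e, he⟩ =>
      ⟨e, hS.add_left_cancel (he.trans (hS.add_assoc _ _ _))⟩
    zero_le_one := ⟨1, (hS.zero_add 1).symm⟩
    exists_pair_ne := ⟨0, 1, fun h => hS.succ_ne_zero 0 ((hS.zero_add 1).trans h.symm)⟩
    mul_lt_mul_of_pos_left := fun _ ha _ _ h => hS.mul_lt_mul_of_pos_left ha h
    mul_lt_mul_of_pos_right := fun a ha b c h => by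
      change b * a < c * a
      rw [hS.mul_comm b, hS.mul_comm c]
      exact hS.mul_lt_mul_of_pos_left ha h
    exists_add_of_le := id
    le_add_self := fun a b => ⟨b, hS.add_comm _ _⟩
    le_self_add := fun a b => ⟨b, rfl⟩
    toSuccOrder := SuccOrder.ofSuccLeIff (· + 1) fun {a b} => by
      rw [← not_lt, hS.lt_succ, ← le_iff_lt_or_eq, not_le]
    succ_eq_add_one := fun _ => rfl }

end SecondOrderArith.IsModelRCA0

/-! ### Successive differences -/

/-- `v` is the tuple of the successive differences of `x`. -/
def HasDifferences {M : Type*} [Add M] {n : ℕ} (x : Fin (n + 1) → M) (v : Fin n → M) : Prop :=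
  ∀ i, x i.succ = x i.castSucc + v i

namespace HasDifferences

section AddCommMonoid

variable {M : Type*} [AddCommMonoid M] {n : ℕ} {x : Fin (n + 1) → M} {v : Fin n → M}

theorem partialSum (v : Fin n → M) : HasDifferences (Fin.partialSum v) v :=
  Fin.partialSum_succ v

theorem add_const (h : HasDifferences x v) (z : M) : HasDifferences (fun i => x i + z) v :=
  fun i => (congrArg (· + z) (h i)).trans (add_right_comm _ _ _)

theorem eq_partialSum_add (h : HasDifferences x v) (i : Fin (n + 1)) :
    x i = Fin.partialSum v i + x 0 := by
  induction i using Fin.induction with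
  | zero => rw [Fin.partialSum_zero, zero_add]
  | succ i ih => rw [h, ih, Fin.partialSum_succ, add_right_comm]

theorem unique [IsLeftCancelAdd M] {w : Fin n → M} (hv : HasDifferences x v)
    (hw : HasDifferences x w) : v = w :=
  funext fun i => add_left_cancel ((hv i).symm.trans (hw i))

theorem strictMono_iff [PartialOrder M] [IsOrderedCancelAddMonoid M] [CanonicallyOrderedAdd M]
    (h : HasDifferences x v) : StrictMono x ↔ ∀ i, v i ≠ 0 := by
  refine Fin.strictMono_iff_lt_succ.trans (forall_congr' fun i => ?_)
  rw [h, lt_add_iff_pos_right, pos_iff_ne_zero]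

theorem sub_eq [PartialOrder M] [Sub M] [OrderedSub M] [AddLeftReflectLE M]
    (h : HasDifferences x v) : (fun i => x i.succ - x i.castSucc) = v :=
  funext fun i => by rw [h i, add_tsub_cancel_left]

end AddCommMonoid

theorem exists_of_strictMono {M : Type*} [Add M] [Preorder M]
    [ExistsAddOfLE M] {n : ℕ} {x : Fin (n + 1) → M} (hx : StrictMono x) :
    ∃ v, HasDifferences x v := by
  choose v hv using fun i : Fin n => exists_add_of_le (hx i.castSucc_lt_succ).le
  exact ⟨v, hv⟩

end HasDifferences

/-! ### Pairs, tuples and extremal elements -/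

namespace SecondOrderArith

section Pairs

variable {M : Type*} [DiscreteOrderedSemiring M]

theorem increasing_iff_strictMono {n : ℕ} {x : Fin n → M} : Increasing x ↔ StrictMono x :=
  ⟨fun h _ _ => h _ _, fun h _ _ => @h _ _⟩

theorem left_le_pair (a b : M) : a ≤ pair a b :=
  le_add_self

theorem right_le_pair (a b : M) : b ≤ pair a b := by
  rcases eq_or_ne (a + b) 0 with h | h
  · exact (le_add_self.trans h.le).trans zero_le
  · have h1 : 1 ≤ a + b := Order.one_le_iff_pos.2 (pos_iff_ne_zero.2 h)
    calc b ≤ a + b := le_add_self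
      _ ≤ (a + b) * (a + b) := le_mul_of_one_le_left zero_le h1
      _ ≤ pair a b := le_self_add

theorem pair_lt_mul_self (a b : M) : pair a b < (a + b + 1) * (a + b + 1) := by
  have : (a + b + 1) * (a + b + 1) = pair a b + (a + b + b) + 1 := by unfold pair; ring
  rw [this, Order.lt_add_one_iff]
  exact le_self_add

theorem add_le_add_of_pair_le {a b a' b' : M} (h : pair a b ≤ pair a' b') : a + b ≤ a' + b' := by
  refine Order.lt_add_one_iff.1 (lt_of_mul_self_lt_mul_self₀ zero_le ?_)
  exact (le_self_add.trans h).trans_lt (pair_lt_mul_self a' b')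

theorem pair_inj {a b a' b' : M} : pair a b = pair a' b' ↔ a = a' ∧ b = b' := by
  refine ⟨fun h => ?_, fun ⟨ha, hb⟩ => by rw [ha, hb]⟩
  have hs : a + b = a' + b' :=
    (add_le_add_of_pair_le h.le).antisymm (add_le_add_of_pair_le h.ge)
  rw [pair, pair, hs] at h
  obtain rfl := add_left_cancel h
  exact ⟨rfl, add_left_cancel hs⟩

theorem tuple_injective {n : ℕ} : Function.Injective (tuple : (Fin n → M) → M) := by
  induction n with
  | zero => exact Function.injective_of_subsingleton _
  | succ n ih =>
    intro x y h
    obtain ⟨h₀, h₁⟩ := pair_inj.1 h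
    exact funext (Fin.cases h₀ (congrFun (ih h₁)))

theorem le_tuple {n : ℕ} (x : Fin n → M) (i : Fin n) : x i ≤ tuple x := by
  induction n with
  | zero => exact i.elim0
  | succ n ih =>
    cases i using Fin.cases with
    | zero => exact left_le_pair _ _
    | succ i => exact (ih (fun i => x i.succ) i).trans (right_le_pair _ _)

theorem IsColouring.lt {n : ℕ} {D : (Fin n → M) → Prop} {C : Set M} {k : M}
    (hC : IsColouring D C k) {x : Fin n → M} {j : M} (h : pair (tuple x) j ∈ C) : j < k := by
  obtain ⟨y, i, -, hi, heq⟩ := hC.1 _ h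
  rwa [(pair_inj.1 heq).2]

theorem TermDef.partialSum {ι : Type} {n : ℕ} {v : Fin n → (ι → M) → M}
    (hv : ∀ i, TermDef (v i)) (i : Fin (n + 1)) :
    TermDef fun x => Fin.partialSum (fun i => v i x) i := by
  induction i using Fin.induction with
  | zero => simpa only [Fin.partialSum_zero] using TermDef.const 0
  | succ i ih => simpa only [Fin.partialSum_succ] using ih.add (hv i)

variable {S : Set (Set M)}

theorem BoundedDef.le {ι : Type} {s t : (ι → M) → M} (hs : TermDef s) (ht : TermDef t) :
    BoundedDef S fun x => s x ≤ t x :=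
  (BoundedDef.lt ht hs).not.congr fun _ => not_lt

/-- The binary relation `R`, as a set of pairs. -/
def pairSet (R : M → M → Prop) : Set M := {w | ∃ a b, w = pair a b ∧ R a b}

theorem pair_mem_pairSet {R : M → M → Prop} {a b : M} : pair a b ∈ pairSet R ↔ R a b := by
  refine ⟨?_, fun h => ⟨a, b, rfl, h⟩⟩
  rintro ⟨a', b', h, hR⟩
  obtain ⟨rfl, rfl⟩ := pair_inj.1 h
  exact hR

theorem isFunction_pairSet {R : M → M → Prop} (hR : ∀ a, ∃! b, R a b) :
    IsFunction (pairSet R) :=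
  ⟨fun _ ⟨a, b, h, _⟩ => ⟨a, b, h⟩, fun a => by simpa only [pair_mem_pairSet] using hR a⟩

/-- The relation `R` between `n`-tuples and numbers, as a set of pairs. -/
def tupleSet {n : ℕ} (R : (Fin n → M) → M → Prop) : Set M :=
  {w | ∃ x j, w = pair (tuple x) j ∧ R x j}

theorem pair_mem_tupleSet {n : ℕ} {R : (Fin n → M) → M → Prop} {x : Fin n → M} {j : M} :
    pair (tuple x) j ∈ tupleSet R ↔ R x j := by
  refine ⟨?_, fun h => ⟨x, j, rfl, h⟩⟩
  rintro ⟨y, i, h, hR⟩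
  obtain ⟨hxy, rfl⟩ := pair_inj.1 h
  rwa [tuple_injective hxy]

theorem isColouring_tupleSet {n : ℕ} {D : (Fin n → M) → Prop} {R : (Fin n → M) → M → Prop} {k : M}
    (hR : ∀ x j, R x j → D x ∧ j < k) (hD : ∀ x, D x → ∃! j, R x j) :
    IsColouring D (tupleSet R) k := by
  refine ⟨?_, fun x hx => by simpa only [pair_mem_tupleSet] using hD x hx⟩
  rintro w ⟨x, j, hw, h⟩
  exact ⟨x, j, (hR x j h).1, (hR x j h).2, hw⟩

namespace IsModelRCA0

theorem pairSet_mem (hS : IsModelRCA0 S) {R : M → M → Prop}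
    (hR : BoundedDef S fun x : Fin 2 → M => R (x 0) (x 1)) : pairSet R ∈ S := by
  have key : {w | ∃ a, a < w + 1 ∧ ∃ b, b < w + 1 ∧ (w = pair a b ∧ R a b)} ∈ S :=
    hS.setOf_mem <| .bex (.add (.var 0) (.const 1)) <| .bex (.add (.var (some 0)) (.const 1)) <|
      .and (.eq (.var (some (some 0))) (.pair (.var (some none)) (.var none)))
        (hR.reindex ![some none, none])
  convert key using 1
  ext w
  refine exists_congr fun a => ⟨?_, fun ⟨_, b, _, h⟩ => ⟨b, h⟩⟩
  rintro ⟨b, rfl, h⟩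
  exact ⟨Order.lt_add_one_iff.2 (left_le_pair a b), b,
    Order.lt_add_one_iff.2 (right_le_pair a b), rfl, h⟩

theorem tupleSet_mem (hS : IsModelRCA0 S) {n : ℕ} {R : (Fin n → M) → M → Prop}
    (hR : BoundedDef S fun y : Fin n ⊕ Fin 1 → M => R (y ∘ Sum.inl) (y (.inr 0))) :
    tupleSet R ∈ S := by
  have key : pairSet (fun m j => ∃ x : Fin n → M, (∀ i, x i < m + 1) ∧ (m = tuple x ∧ R x j)) ∈ S :=
    hS.pairSet_mem <| .bex_fin (.add (.var 0) (.const 1)) <|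
      .and (.eq (.var (Sum.inr 0)) (.tuple fun i => .var (Sum.inl i)))
        (hR.reindex (Sum.elim Sum.inl fun _ => Sum.inr 1))
  convert key using 1
  ext w
  constructor
  · rintro ⟨x, j, hw, h⟩
    exact ⟨_, j, hw, x, fun i => Order.lt_add_one_iff.2 (le_tuple x i), rfl, h⟩
  · rintro ⟨_, j, hw, x, -, rfl, h⟩
    exact ⟨x, j, hw, h⟩

theorem exists_isLeast (hS : IsModelRCA0 S) {P : M → Prop}
    (hP : BoundedDef S fun x : Fin 1 → M => P (x 0)) (hne : ∃ a, P a) :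
    ∃ a, IsLeast {a | P a} a := by
  by_contra! h
  have key (a : M) : ∀ b, b < a → ¬ P b := by
    refine hS.induction_bounded (P := fun a => ∀ b, b < a → ¬ P b)
      (.ball (.var 0) (hP.reindex fun _ => none).not) (fun b hb => absurd hb (hS.not_lt_zero b))
      (fun a ih b hb hPb => h b ⟨hPb, fun c hc => ?_⟩) a
    exact (Order.lt_add_one_iff.1 hb).trans (not_lt.1 fun hca => ih c hca hc)
  obtain ⟨a, ha⟩ := hne
  exact key (a + 1) a (lt_add_one a) ha

theorem exists_isGreatest_lt (hS : IsModelRCA0 S) {A : Set M} (hA : A ∈ S) {a b : M}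
    (ha : a ∈ A) (hab : a < b) : ∃ c, IsGreatest {x ∈ A | x < b} c := by
  obtain ⟨c, hc⟩ : ∃ c, (∃ x, x < b ∧ x ∈ A) → (c ∈ A ∧ c < b) ∧ ∀ x, x < b → x ∈ A → x ≤ c := by
    refine hS.induction_exists
      (P := fun b c => (∃ x, x < b ∧ x ∈ A) → (c ∈ A ∧ c < b) ∧ ∀ x, x < b → x ∈ A → x ≤ c)
      (.imp (.bex (.var 0) (.mem (.var none) hA)) <|
        .and (.and (.mem (.var 1) hA) (.lt (.var 1) (.var 0))) <|
          .ball (.var 0) (.imp (.mem (.var none) hA) (.le (.var none) (.var (some 1)))))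
      ⟨0, fun ⟨x, hx, _⟩ => absurd hx (hS.not_lt_zero x)⟩ (fun b ⟨c, hc⟩ => ?_) b
    by_cases hb : b ∈ A
    · exact ⟨b, fun _ => ⟨⟨hb, lt_add_one b⟩, fun x hx _ => Order.lt_add_one_iff.1 hx⟩⟩
    have hlt {x : M} (hx : x < b + 1) (hxA : x ∈ A) : x < b :=
      (Order.lt_add_one_iff.1 hx).lt_of_ne fun h => hb (h ▸ hxA)
    refine ⟨c, fun ⟨x, hx, hxA⟩ => ?_⟩
    obtain ⟨⟨hcA, hcb⟩, hmax⟩ := hc ⟨x, hlt hx hxA, hxA⟩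
    exact ⟨⟨hcA, hcb.trans (lt_add_one b)⟩, fun y hy hyA => hmax y (hlt hy hyA) hyA⟩
  exact ⟨c, (hc ⟨a, hab, ha⟩).1, fun x hx => (hc ⟨a, hab, ha⟩).2 x hx.2 hx.1⟩

theorem exists_isLeast_gt (hS : IsModelRCA0 S) {X : Set M} (hX : X ∈ S)
    (hu : Unbounded X) (a : M) : ∃ b, IsLeast {x | x ∈ X ∧ a < x} b :=
  hS.exists_isLeast (.and (.mem (.var 0) hX) (.lt (.const a) (.var 0))) (hu a)

theorem exists_consecutive (hS : IsModelRCA0 S) {X : Set M} (hX : X ∈ S)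
    (hu : Unbounded X) {a : M} (ha : a ∈ X) : ∃ b, Consecutive X a b := by
  obtain ⟨b, hb, hmin⟩ := hS.exists_isLeast_gt hX hu a
  exact ⟨b, ha, hb.1, hb.2, fun c hc h => (hmin ⟨hc, h.1⟩).not_gt h.2⟩

theorem exists_consecutive_of_lt (hS : IsModelRCA0 S) {X : Set M} (hX : X ∈ S)
    {a b : M} (ha : a ∈ X) (hb : b ∈ X) (hab : a < b) : ∃ c, a ≤ c ∧ Consecutive X c b := by
  obtain ⟨c, hc, hmax⟩ := hS.exists_isGreatest_lt hX ha hab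
  exact ⟨c, hmax ⟨ha, hab⟩, hc.1, hb, hc.2, fun x hx h => (hmax ⟨hx, h.2⟩).not_gt h.1⟩

end IsModelRCA0

end Pairs

end SecondOrderArith

/-! ### From the adjacent Hindman theorem to the `ℤ`-Ramsey theorem, in models of `RCA₀` -/

namespace SecondOrderArith

section SumSets

variable {M : Type*} [DiscreteOrderedSemiring M] {S : Set (Set M)} {Y s : Set M}

theorem IsFunction.unique {f : Set M} (hf : IsFunction f) {n p q : M} (hp : pair n p ∈ f)
    (hq : pair n q ∈ f) : p = q :=
  (hf.2 n).unique hp hq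

theorem IsFunction.monotone (hS : IsModelRCA0 S) {f : Set M} (hfS : f ∈ S) (hf : IsFunction f)
    (hstep : ∀ n p, pair n p ∈ f → ∃ q, p ≤ q ∧ pair (n + 1) q ∈ f) {m n p q : M} (hmn : m ≤ n)
    (hp : pair m p ∈ f) (hq : pair n q ∈ f) : p ≤ q := by
  obtain ⟨k, rfl⟩ := exists_add_of_le hmn
  obtain ⟨b, hb, hpb⟩ : ∃ b, pair (m + k) b ∈ f ∧ p ≤ b := by
    refine hS.induction_exists (P := fun k b => pair (m + k) b ∈ f ∧ p ≤ b)
      (.and (.mem (.pair (.add (.const m) (.var 0)) (.var 1)) hfS) (.le (.const p) (.var 1)))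
      ⟨p, by rwa [add_zero], le_rfl⟩ (fun k ⟨b, hb, hpb⟩ => ?_) k
    obtain ⟨q, hq, h⟩ := hstep _ _ hb
    exact ⟨q, by rwa [← add_assoc], hpb.trans hq⟩
  exact hpb.trans_eq (hf.unique hb hq)

theorem IsExpTwo.monotone (hS : IsModelRCA0 S) {E : Set M} (hES : E ∈ S) (hE : IsExpTwo E)
    {m n p q : M} (hmn : m ≤ n) (hp : pair m p ∈ E) (hq : pair n q ∈ E) : p ≤ q :=
  hE.1.monotone hS hES (fun n p h => ⟨p + p, le_self_add, hE.2.2 n p h⟩) hmn hp hq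

theorem MuLtLam.pos_and_lt (hS : IsModelRCA0 S) {x y : M} (h : MuLtLam S x y) :
    0 < x ∧ x < y := by
  obtain ⟨E, hES, hE, m, l, ⟨p, q, hp, hq, hpx, hxq⟩, ⟨r, _, hr, -, ⟨t, rfl⟩, hndvd⟩, hml⟩ := h
  have one_le_p : 1 ≤ p := hE.monotone hS hES zero_le hE.2.1 hp
  have q_le_r : q ≤ r := hE.monotone hS hES (Order.add_one_le_iff.2 hml) hq hr
  have ht : t ≠ 0 := by
    rintro rfl
    exact hndvd ⟨0, by rw [mul_zero, mul_zero]⟩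
  refine ⟨one_pos.trans_le (one_le_p.trans (not_lt.1 hpx)), hxq.trans_le (q_le_r.trans ?_)⟩
  exact le_mul_of_one_le_right zero_le (Order.one_le_iff_pos.2 (pos_iff_ne_zero.2 ht))

namespace IsSumFunction

theorem monotone (hS : IsModelRCA0 S) (hsS : s ∈ S) (hs : IsSumFunction Y s) {m n p q : M}
    (hmn : m ≤ n) (hp : pair m p ∈ s) (hq : pair n q ∈ s) : p ≤ q := by
  refine hs.1.monotone hS hsS (fun n p h => ?_) hmn hp hq
  by_cases hn : n ∈ Y
  · exact ⟨p + n, le_self_add, (hs.2.2 n p h).1 hn⟩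
  · exact ⟨p, le_rfl, (hs.2.2 n p h).2 hn⟩

theorem eq_of_disjoint (hS : IsModelRCA0 S) (hsS : s ∈ S) (hs : IsSumFunction Y s) {m n p : M}
    (hmn : m ≤ n) (hp : pair m p ∈ s) (hY : ∀ y ∈ Y, m ≤ y → n ≤ y) : pair n p ∈ s := by
  obtain ⟨k, rfl⟩ := exists_add_of_le hmn
  refine hS.induction_bounded (P := fun j => j ≤ k → pair (m + j) p ∈ s)
    (.imp (.le (.var 0) (.const k)) (.mem (.pair (.add (.const m) (.var 0)) (.const p)) hsS))
    (fun _ => by rwa [add_zero]) (fun j ih hj => ?_) k le_rfl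
  have hj : j < k := Order.add_one_le_iff.1 hj
  rw [← add_assoc]
  exact (hs.2.2 _ _ (ih hj.le)).2 fun h => (hY _ h le_self_add).not_gt (add_lt_add_right hj m)

end IsSumFunction

/-- The set of the sums of initial segments of `Y`, where `s` is the sum function of `Y`. -/
def sumSet (s : Set M) : Set M := {x | ∃ m, pair m x ∈ s}

namespace IsSumFunction

/-- The sum of a nonempty initial segment is at least its last term, which bounds the search for
the least `m` with value `x`. -/
theorem exists_lt_of_mem_sumSet (hS : IsModelRCA0 S) (hsS : s ∈ S) (hs : IsSumFunction Y s)
    {x : M} (hx : x ∈ sumSet s) : ∃ m, m < x + 1 + 1 ∧ pair m x ∈ s := by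
  obtain ⟨m, hm, hmin⟩ := hS.exists_isLeast (P := fun m => pair m x ∈ s)
    (.mem (.pair (.var 0) (.const x)) hsS) hx
  refine ⟨m, Order.lt_add_one_iff.2 ?_, hm⟩
  obtain rfl | ⟨n, rfl⟩ := hS.eq_zero_or_succ m
  · exact zero_le
  obtain ⟨p, hp, -⟩ := hs.1.2 n
  by_cases hn : n ∈ Y
  · obtain rfl : x = p + n := hs.1.unique hm ((hs.2.2 n p hp).1 hn)
    exact add_le_add_left le_add_self 1
  · obtain rfl : x = p := hs.1.unique hm ((hs.2.2 n p hp).2 hn)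
    exact absurd (hmin hp) (lt_add_one n).not_ge

theorem sumSet_mem (hS : IsModelRCA0 S) (hsS : s ∈ S) (hs : IsSumFunction Y s) :
    sumSet s ∈ S := by
  have key : {x | ∃ m, m < x + 1 + 1 ∧ pair m x ∈ s} ∈ S :=
    hS.setOf_mem <| .bex (.add (.add (.var 0) (.const 1)) (.const 1)) <|
      .mem (.pair (.var none) (.var (some 0))) hsS
  convert key using 1
  exact Set.ext fun x => ⟨hs.exists_lt_of_mem_sumSet hS hsS, fun ⟨m, _, h⟩ => ⟨m, h⟩⟩

theorem exists_of_mem_sumSet (hS : IsModelRCA0 S) (hYS : Y ∈ S) (hu : Unbounded Y) (hsS : s ∈ S)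
    (hs : IsSumFunction Y s) {x : M} (hx : x ∈ sumSet s) : ∃ y ∈ Y, pair y x ∈ s := by
  obtain ⟨m, hm⟩ := hx
  by_cases hmY : m ∈ Y
  · exact ⟨m, hmY, hm⟩
  obtain ⟨y, hy, hmin⟩ := hS.exists_isLeast_gt hYS hu m
  exact ⟨y, hy.1, hs.eq_of_disjoint hS hsS hy.2.le hm fun z hz hmz =>
    hmin ⟨hz, lt_of_le_of_ne hmz fun h => hmY (h ▸ hz)⟩⟩

theorem unbounded_sumSet (hu : Unbounded Y) (hs : IsSumFunction Y s) : Unbounded (sumSet s) := by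
  intro m
  obtain ⟨y, hy, hmy⟩ := hu m
  obtain ⟨p, hp, -⟩ := hs.1.2 y
  exact ⟨p + y, ⟨y + 1, (hs.2.2 y p hp).1 hy⟩, hmy.trans_le le_add_self⟩

theorem eq_add_of_consecutive (hS : IsModelRCA0 S) (hsS : s ∈ S) (hs : IsSumFunction Y s)
    {a b y : M} (hy : y ∈ Y) (hy0 : 0 < y) (ha : pair y a ∈ s)
    (hab : Consecutive (sumSet s) a b) : b = a + y := by
  have hay := (hs.2.2 y a ha).1 hy
  obtain ⟨-, ⟨m, hm⟩, hlt, hbetween⟩ := hab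
  refine le_antisymm (not_lt.1 fun h => ?_) ?_
  · exact hbetween _ ⟨_, hay⟩ ⟨lt_add_of_pos_right a hy0, h⟩
  · have hym : y < m := not_le.1 fun hmy => (hs.monotone hS hsS hmy hm ha).not_gt hlt
    exact hs.monotone hS hsS (Order.add_one_le_iff.2 hym) hay hm

theorem pair_add_mem_of_consecutive (hS : IsModelRCA0 S) (hsS : s ∈ S) (hs : IsSumFunction Y s)
    {a y z : M} (ha : pair y a ∈ s) (hyz : Consecutive Y y z) : pair z (a + y) ∈ s :=
  hs.eq_of_disjoint hS hsS (Order.add_one_le_iff.2 hyz.2.2.1) ((hs.2.2 y a ha).1 hyz.1)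
    fun x hx hyx => not_lt.1 fun hxz => hyz.2.2.2 x hx ⟨Order.add_one_le_iff.1 hyx, hxz⟩

theorem separated_sumSet (hS : IsModelRCA0 S) (hYS : Y ∈ S) (hu : Unbounded Y) (hap : Apart S Y)
    (hsS : s ∈ S) (hs : IsSumFunction Y s) : Separated S (sumSet s) := by
  intro a b c hab hbc
  obtain ⟨y, hy, hya⟩ := hs.exists_of_mem_sumSet hS hYS hu hsS hab.1
  obtain ⟨z, hyz⟩ := hS.exists_consecutive hYS hu hy
  obtain ⟨hy0, hlt⟩ := (hap y z hyz).pos_and_lt hS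
  obtain rfl := hs.eq_add_of_consecutive hS hsS hy hy0 hya hab
  have hzb := hs.pair_add_mem_of_consecutive hS hsS hya hyz
  exact ⟨y, z, rfl, hs.eq_add_of_consecutive hS hsS hyz.2.1 (hy0.trans hlt) hzb hbc, hap y z hyz⟩

end IsSumFunction

/-- The colouring of `d`-tuples that maps `v` to the colour of the set of the partial sums of `v`,
and to `0` if `v` has an entry `0`. -/
def sumColouring (d : ℕ) (C : Set M) : Set M :=
  tupleSet fun (v : Fin d → M) j =>
    (∀ i, v i ≠ 0) ∧ pair (tuple (Fin.partialSum v)) j ∈ C ∨ (¬ ∀ i, v i ≠ 0) ∧ j = 0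

theorem increasing_partialSum {n : ℕ} {v : Fin n → M} :
    Increasing (Fin.partialSum v) ↔ ∀ i, v i ≠ 0 :=
  increasing_iff_strictMono.trans (HasDifferences.partialSum v).strictMono_iff

theorem sumColouring_mem (hS : IsModelRCA0 S) (d : ℕ) {C : Set M} (hC : C ∈ S) :
    sumColouring d C ∈ S := by
  have nonzero : BoundedDef S fun y : Fin d ⊕ Fin 1 → M => ∀ i, y (.inl i) ≠ 0 :=
    .forall_fin fun i => .not (.eq (.var _) (.const 0))
  exact hS.tupleSet_mem <| .or
    (nonzero.and (.mem (.pair (.tuple (.partialSum fun i => .var (Sum.inl i))) (.var _)) hC))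
    (nonzero.not.and (.eq (.var _) (.const 0)))

theorem isColouring_sumColouring {d : ℕ} {C : Set M} {k : M}
    (hC : IsColouring (fun x : Fin (d + 1) → M => Increasing x) C k) :
    IsColouring (fun _ : Fin d → M => True) (sumColouring d C) (k + 1) := by
  refine isColouring_tupleSet (fun v j h => ⟨trivial, ?_⟩) fun v _ => ?_
  · rcases h with ⟨-, h⟩ | ⟨-, rfl⟩
    · exact Order.lt_add_one_iff.2 (hC.lt h).le
    · exact Order.lt_add_one_iff.2 zero_le
  · by_cases hv : ∀ i, v i ≠ 0
    · simpa [hv] using hC.2 _ (increasing_partialSum.2 hv)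
    · simp [hv]

theorem pair_mem_of_mem_sumColouring {d : ℕ} {C : Set M} (hZ : ZInvariant (d + 1) C)
    {x : Fin (d + 1) → M} {v : Fin d → M} (hxv : HasDifferences x v) (hx : Increasing x) {j : M}
    (h : pair (tuple v) j ∈ sumColouring d C) : pair (tuple x) j ∈ C := by
  have hv := hxv.strictMono_iff.1 (increasing_iff_strictMono.1 hx)
  rcases pair_mem_tupleSet.1 h with ⟨-, h⟩ | ⟨h, -⟩
  · rw [funext hxv.eq_partialSum_add]
    exact (hZ _ (increasing_partialSum.2 hv) (x 0) j).1 h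
  · exact absurd hv h

theorem satSepZRT_of_satApAHT (hS : IsModelRCA0 S) {d : ℕ} (h : SatApAHT d S) :
    SatSepZRT (d + 1) S := by
  intro k C hCS hC hZ
  obtain ⟨Y, hYS, hu, hap, s, hsS, hs, i, hi⟩ :=
    h (k + 1) _ (sumColouring_mem hS d hCS) (isColouring_sumColouring hC)
  refine ⟨sumSet s, hs.sumSet_mem hS hsS, hs.unbounded_sumSet hu,
    hs.separated_sumSet hS hYS hu hap hsS, i, fun x hx hxs => ?_⟩
  choose y hyY hys using fun j => hs.exists_of_mem_sumSet hS hYS hu hsS (hxs j)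
  obtain ⟨z, hz⟩ := HasDifferences.exists_of_strictMono (increasing_iff_strictMono.1 hx)
  have hy : Increasing y := fun a b hab =>
    not_le.1 fun hba => (hx a b hab).not_ge (hs.monotone hS hsS hba (hys _) (hys _))
  have hAFS : IsAFS d Y s z := ⟨y, hy, hyY, fun j => ⟨x j.castSucc, hys _, hz j ▸ hys _⟩⟩
  exact pair_mem_of_mem_sumColouring hZ hz hx (hi z hAFS)

end SumSets

end SecondOrderArith

/-! ### From the `ℤ`-Ramsey theorem to the adjacent Hindman theorem, in models of `RCA₀` -/

namespace SecondOrderArith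

section GapSets

variable {M : Type*} [DiscreteOrderedSemiring M] {S : Set (Set M)} {X : Set M}

/-- No element of `X` lies strictly between `a` and `a + m`: for `a ∈ X`, the gap of `X` after `a`
is at least `m`. -/
def GapGE (X : Set M) (a m : M) : Prop := ∀ c, c < a + m → c ∈ X → c ≤ a

/-- The set of the differences of consecutive elements of `X`. -/
def gapSet (X : Set M) : Set M := {y | ∃ a, Consecutive X a (a + y)}

theorem GapGE.zero (X : Set M) (a : M) : GapGE X a 0 :=
  fun _ hc _ => (hc.trans_eq (add_zero a)).le

theorem GapGE.mono {a m n : M} (h : GapGE X a n) (hmn : m ≤ n) : GapGE X a m :=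
  fun c hc => h c (hc.trans_le (add_le_add_right hmn a))

theorem consecutive_add_iff {a y : M} :
    Consecutive X a (a + y) ↔ a ∈ X ∧ a + y ∈ X ∧ a < a + y ∧ GapGE X a y := by
  refine and_congr_right fun _ => and_congr_right fun _ => and_congr_right fun _ => ?_
  exact ⟨fun h c hc hcX => not_lt.1 fun hac => h c hcX ⟨hac, hc⟩,
    fun h c hcX hc => (h c hc.2 hcX).not_gt hc.1⟩

namespace Consecutive

theorem gapGE_iff {a y m : M} (h : Consecutive X a (a + y)) : GapGE X a m ↔ m ≤ y :=
  ⟨fun hm => not_lt.1 fun hlt => (hm _ (add_lt_add_right hlt a) h.2.1).not_gt h.2.2.1,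
    (consecutive_add_iff.1 h).2.2.2.mono⟩

theorem exists_add {a b : M} (h : Consecutive X a b) : ∃ y, b = a + y :=
  exists_add_of_le h.2.2.1.le

theorem le_of_lt {a b c : M} (h : Consecutive X a b) (hc : c ∈ X) (hac : a < c) : b ≤ c :=
  not_lt.1 fun hcb => h.2.2.2 c hc ⟨hac, hcb⟩

end Consecutive

theorem BoundedDef.gapGE (hX : X ∈ S) {ι : Type} {s t : (ι → M) → M} (hs : TermDef s)
    (ht : TermDef t) : BoundedDef S fun x => GapGE X (s x) (t x) :=
  .ball (hs.add ht) (.imp (.mem (.var none) hX) (.le (.var none) (hs.reindex some)))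

theorem BoundedDef.consecutive_add (hX : X ∈ S) {ι : Type} {s t : (ι → M) → M} (hs : TermDef s)
    (ht : TermDef t) : BoundedDef S fun x => Consecutive X (s x) (s x + t x) :=
  BoundedDef.congr (.and (.mem hs hX) (.and (.mem (hs.add ht) hX) (.and (.lt hs (hs.add ht))
    (.gapGE hX hs ht)))) fun _ => consecutive_add_iff.symm

/-- `X` is an infinite set of the model with strictly increasing gaps; this is all that the
definability of `gapSet X` and of its sum function uses of the separation condition. -/
structure HasIncreasingGaps (S : Set (Set M)) (X : Set M) : Prop where
  mem : X ∈ S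
  unbounded : Unbounded X
  gap_lt_gap : ∀ a p q, Consecutive X a (a + p) → Consecutive X (a + p) (a + p + q) → p < q

theorem Separated.hasIncreasingGaps (hS : IsModelRCA0 S) (hX : X ∈ S) (hu : Unbounded X)
    (h : Separated S X) : HasIncreasingGaps S X := by
  refine ⟨hX, hu, fun a p q hp hq => ?_⟩
  obtain ⟨p', q', hp', hq', hmu⟩ := h _ _ _ hp hq
  rw [add_left_cancel hp', add_left_cancel hq']
  exact (hmu.pos_and_lt hS).2

namespace HasIncreasingGaps

theorem exists_gap (hS : IsModelRCA0 S) (hX : HasIncreasingGaps S X) {a : M} (ha : a ∈ X) :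
    ∃ y, Consecutive X a (a + y) := by
  obtain ⟨b, hb⟩ := hS.exists_consecutive hX.mem hX.unbounded ha
  obtain ⟨y, rfl⟩ := hb.exists_add
  exact ⟨y, hb⟩

theorem gap_lt (hS : IsModelRCA0 S) (hX : HasIncreasingGaps S X) {a b y z : M}
    (ha : Consecutive X a (a + y)) (hb : Consecutive X b (b + z)) (hab : a < b) : y < z := by
  by_contra! hzy
  -- The least element after `a` whose gap is at most `y` contradicts `gap_lt_gap` at its
  -- predecessor.
  obtain ⟨e, ⟨heX, hae, hey⟩, hmin⟩ := hS.exists_isLeast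
    (P := fun x => x ∈ X ∧ a < x ∧ ¬ GapGE X x (y + 1))
    (.and (.mem (.var 0) hX.mem) <| .and (.lt (.const a) (.var 0)) <|
      .not (.gapGE hX.mem (.var 0) (.add (.const y) (.const 1))))
    ⟨b, hb.1, hab, fun h => (Order.add_one_le_iff.1 (hb.gapGE_iff.1 h)).not_ge hzy⟩
  obtain ⟨w, hw⟩ := hX.exists_gap hS heX
  rw [hw.gapGE_iff, Order.add_one_le_iff, not_lt] at hey
  rcases (ha.le_of_lt heX hae).eq_or_lt with rfl | hlt
  · exact (hX.gap_lt_gap a y w ha hw).not_ge hey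
  · obtain ⟨c, hc, hce⟩ := hS.exists_consecutive_of_lt hX.mem ha.2.1 heX hlt
    obtain ⟨u, rfl⟩ := hce.exists_add
    have huw : u < w := hX.gap_lt_gap c u w hce hw
    refine hce.2.2.1.not_ge (hmin ⟨hce.1, ha.2.2.1.trans_le hc, fun h => ?_⟩)
    exact ((Order.add_one_le_iff.1 (hce.gapGE_iff.1 h)).trans huw).not_ge hey

theorem lt_of_gap_lt (hS : IsModelRCA0 S) (hX : HasIncreasingGaps S X) {a b y z : M}
    (ha : Consecutive X a (a + y)) (hb : Consecutive X b (b + z)) (hyz : y < z) : a < b := by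
  rcases lt_trichotomy a b with h | rfl | h
  · exact h
  · exact absurd (ha.gapGE_iff.1 (hb.gapGE_iff.2 le_rfl)) hyz.not_ge
  · exact absurd (hX.gap_lt hS hb ha h) hyz.not_gt

theorem exists_gapGE (hS : IsModelRCA0 S) (hX : HasIncreasingGaps S X) (m : M) :
    ∃ a, a ∈ X ∧ GapGE X a m := by
  refine hS.induction_exists (P := fun m a => a ∈ X ∧ GapGE X a m)
    (.and (.mem (.var 1) hX.mem) (.gapGE hX.mem (.var 1) (.var 0))) ?_ ?_ m
  · obtain ⟨a, ha, -⟩ := hX.unbounded 0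
    exact ⟨a, ha, .zero X a⟩
  · rintro m ⟨a, ha, hm⟩
    obtain ⟨y, hy⟩ := hX.exists_gap hS ha
    obtain ⟨z, hz⟩ := hX.exists_gap hS hy.2.1
    refine ⟨a + y, hy.2.1, hz.gapGE_iff.2 (Order.add_one_le_iff.2 ?_)⟩
    exact (hy.gapGE_iff.1 hm).trans_lt (hX.gap_lt hS hy hz hy.2.2.1)

theorem unbounded_gapSet (hS : IsModelRCA0 S) (hX : HasIncreasingGaps S X) :
    Unbounded (gapSet X) := by
  intro m
  obtain ⟨a, ha, hm⟩ := hX.exists_gapGE hS (m + 1)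
  obtain ⟨y, hy⟩ := hX.exists_gap hS ha
  exact ⟨y, ⟨a, hy⟩, Order.add_one_le_iff.1 (hy.gapGE_iff.1 hm)⟩

theorem lt_of_gapGE (hS : IsModelRCA0 S) (hX : HasIncreasingGaps S X) {a b y : M}
    (ha : Consecutive X a (a + y)) (hb : b ∈ X) (hgap : GapGE X b (y + 1)) : a < b := by
  obtain ⟨z, hz⟩ := hX.exists_gap hS hb
  exact hX.lt_of_gap_lt hS ha hz (Order.add_one_le_iff.1 (hz.gapGE_iff.1 hgap))

theorem mem_gapSet_iff (hS : IsModelRCA0 S) (hX : HasIncreasingGaps S X) {a y : M} (ha : a ∈ X)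
    (hay : GapGE X a (y + 1)) : y ∈ gapSet X ↔ ∃ b, b < a ∧ Consecutive X b (b + y) :=
  ⟨fun ⟨b, hb⟩ => ⟨b, hX.lt_of_gapGE hS hb ha hay, hb⟩, fun ⟨b, _, hb⟩ => ⟨b, hb⟩⟩

-- As the gaps increase, it is enough to look for `y` before the first gap that exceeds `y`.
theorem gapSet_mem (hS : IsModelRCA0 S) (hX : HasIncreasingGaps S X) : gapSet X ∈ S := by
  refine hS.setOf_mem_of_iff (P := fun y a => Consecutive X a (a + y))
    (Q := fun y a => a ∈ X ∧ GapGE X a (y + 1) → ∃ b, b < a ∧ Consecutive X b (b + y))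
    (.consecutive_add hX.mem (.var 1) (.var 0))
    (.imp (.and (.mem (.var 1) hX.mem) (.gapGE hX.mem (.var 1) (.add (.var 0) (.const 1))))
      (.bex (.var 1) (.consecutive_add hX.mem (.var none) (.var (some 0))))) fun y => ?_
  obtain ⟨a, ha⟩ := hX.exists_gapGE hS (y + 1)
  exact ⟨fun h b hb => (hX.mem_gapSet_iff hS hb.1 hb.2).1 h,
    fun h => (hX.mem_gapSet_iff hS ha.1 ha.2).2 (h a ha)⟩

theorem consecutive_gapSet (hS : IsModelRCA0 S) (hX : HasIncreasingGaps S X) {y z : M}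
    (h : Consecutive (gapSet X) y z) :
    ∃ a, Consecutive X a (a + y) ∧ Consecutive X (a + y) (a + y + z) := by
  obtain ⟨⟨a, ha⟩, ⟨b, hb⟩, hyz, hbetween⟩ := h
  refine ⟨a, ha, ?_⟩
  rcases (ha.le_of_lt hb.1 (hX.lt_of_gap_lt hS ha hb hyz)).eq_or_lt with rfl | hlt
  · exact hb
  · obtain ⟨w, hw⟩ := hX.exists_gap hS ha.2.1
    exact absurd ⟨hX.gap_lt hS ha hw ha.2.2.1, hX.gap_lt hS hw hb hlt⟩ (hbetween w ⟨_, hw⟩)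

end HasIncreasingGaps

theorem Separated.apart_gapSet (hS : IsModelRCA0 S) (hX : X ∈ S) (hu : Unbounded X)
    (h : Separated S X) : Apart S (gapSet X) := by
  intro y z hyz
  obtain ⟨a, hy, hz⟩ := (h.hasIncreasingGaps hS hX hu).consecutive_gapSet hS hyz
  obtain ⟨p, q, hp, hq, hmu⟩ := h _ _ _ hy hz
  rwa [add_left_cancel hp, add_left_cancel hq]

/-- The sum function of `gapSet X`, where `x₀` is the least element of `X`. The gaps below `m` are
the first ones, so their sum is the difference between the least `a ∈ X` with a gap of at least `m`
and `x₀`. -/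
def gapSum (X : Set M) (x₀ : M) : Set M :=
  pairSet fun m p => IsLeast {a | a ∈ X ∧ GapGE X a m} (x₀ + p)

theorem gapSum_mem (hS : IsModelRCA0 S) (hX : X ∈ S) (x₀ : M) : gapSum X x₀ ∈ S := by
  have hleast : BoundedDef S fun x : Fin 2 → M =>
      (x₀ + x 1 ∈ X ∧ GapGE X (x₀ + x 1) (x 0)) ∧
        ∀ a, a < x₀ + x 1 → ¬ (a ∈ X ∧ GapGE X a (x 0)) :=
    have ht : TermDef fun x : Fin 2 → M => x₀ + x 1 := .add (.const x₀) (.var 1)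
    .and (.and (.mem ht hX) (.gapGE hX ht (.var 0))) <|
      .ball ht (.not (.and (.mem (.var none) hX) (.gapGE hX (.var none) (.var (some 0)))))
  refine hS.pairSet_mem (hleast.congr fun x => and_congr_right fun _ => ?_)
  exact forall_congr' fun a => ⟨fun h ha => not_lt.1 fun hlt => h hlt ha,
    fun h hlt ha => (h ha).not_gt hlt⟩

namespace HasIncreasingGaps

theorem isLeast_gapGE (hS : IsModelRCA0 S) (hX : HasIncreasingGaps S X) {a y : M}
    (h : Consecutive X a (a + y)) : IsLeast {a | a ∈ X ∧ GapGE X a y} a := by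
  refine ⟨⟨h.1, h.gapGE_iff.2 le_rfl⟩, fun b ⟨hb, hby⟩ => not_lt.1 fun hba => ?_⟩
  obtain ⟨z, hz⟩ := hX.exists_gap hS hb
  exact (hX.gap_lt hS hz h hba).not_ge (hz.gapGE_iff.1 hby)

theorem isLeast_gapGE_add_one (hS : IsModelRCA0 S) (hX : HasIncreasingGaps S X) {a y : M}
    (h : Consecutive X a (a + y)) : IsLeast {a | a ∈ X ∧ GapGE X a (y + 1)} (a + y) := by
  obtain ⟨z, hz⟩ := hX.exists_gap hS h.2.1
  exact ⟨⟨h.2.1, hz.gapGE_iff.2 (Order.add_one_le_iff.2 (hX.gap_lt hS h hz h.2.2.1))⟩,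
    fun b ⟨hb, hby⟩ => h.le_of_lt hb (hX.lt_of_gapGE hS h hb hby)⟩

theorem isLeast_gapGE_of_notMem (hS : IsModelRCA0 S) (hX : HasIncreasingGaps S X) {a m : M}
    (ha : IsLeast {a | a ∈ X ∧ GapGE X a m} a) (hm : m ∉ gapSet X) :
    IsLeast {a | a ∈ X ∧ GapGE X a (m + 1)} a := by
  obtain ⟨y, hy⟩ := hX.exists_gap hS ha.1.1
  have hmy : m ≠ y := fun h => hm ⟨a, h ▸ hy⟩
  exact ⟨⟨hy.1, hy.gapGE_iff.2 (Order.add_one_le_iff.2 ((hy.gapGE_iff.1 ha.1.2).lt_of_ne hmy))⟩,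
    fun b ⟨hb, hbm⟩ => ha.2 ⟨hb, hbm.mono le_self_add⟩⟩

theorem isFunction_gapSum (hS : IsModelRCA0 S) (hX : HasIncreasingGaps S X) {x₀ : M}
    (hx₀ : x₀ ∈ lowerBounds X) : IsFunction (gapSum X x₀) := by
  refine isFunction_pairSet fun m => ?_
  obtain ⟨a, ha⟩ := hS.exists_isLeast (P := fun a => a ∈ X ∧ GapGE X a m)
    (.and (.mem (.var 0) hX.mem) (.gapGE hX.mem (.var 0) (.const m))) (hX.exists_gapGE hS m)
  obtain ⟨p, rfl⟩ := exists_add_of_le (hx₀ ha.1.1)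
  exact ⟨p, ha, fun q hq => add_left_cancel (hq.unique ha)⟩

theorem isSumFunction_gapSum (hS : IsModelRCA0 S) (hX : HasIncreasingGaps S X) {x₀ : M}
    (hx₀ : IsLeast X x₀) : IsSumFunction (gapSet X) (gapSum X x₀) := by
  refine ⟨hX.isFunction_gapSum hS hx₀.2, ?_, fun m p hm => ⟨fun hmX => ?_, fun hmX => ?_⟩⟩
  · rw [gapSum, pair_mem_pairSet, add_zero]
    exact ⟨⟨hx₀.1, .zero X x₀⟩, fun a ha => hx₀.2 ha.1⟩
  · rw [gapSum, pair_mem_pairSet] at hm ⊢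
    obtain ⟨a, ha⟩ := hmX
    obtain rfl := (hX.isLeast_gapGE hS ha).unique hm
    rw [← add_assoc]
    exact hX.isLeast_gapGE_add_one hS ha
  · rw [gapSum, pair_mem_pairSet] at hm ⊢
    exact hX.isLeast_gapGE_of_notMem hS hm hmX

theorem exists_hasDifferences_of_isAFS (hS : IsModelRCA0 S) (hX : HasIncreasingGaps S X)
    {x₀ : M} {d : ℕ} {z : Fin d → M} (hz : IsAFS d (gapSet X) (gapSum X x₀) z) :
    ∃ x, Increasing x ∧ (∀ j, x j ∈ X) ∧ HasDifferences x z := by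
  obtain ⟨m, hm, hmX, hz⟩ := hz
  choose x hx using hmX
  have hsum {j p} (hp : pair (m j) p ∈ gapSum X x₀) : x j = x₀ + p := by
    rw [gapSum, pair_mem_pairSet] at hp
    exact (hX.isLeast_gapGE hS (hx j)).unique hp
  refine ⟨x, fun a b hab => hX.lt_of_gap_lt hS (hx a) (hx b) (hm a b hab), fun j => (hx j).1,
    fun j => ?_⟩
  obtain ⟨p, hp, hp'⟩ := hz j
  rw [hsum hp, hsum hp', add_assoc]

end HasIncreasingGaps

/-- The colouring of increasing `d + 1`-tuples that maps `x` to the colour of the tuple of its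
successive differences. -/
def diffColouring (d : ℕ) (C : Set M) : Set M :=
  tupleSet fun (x : Fin (d + 1) → M) j =>
    Increasing x ∧ ∃ v : Fin d → M, HasDifferences x v ∧ pair (tuple v) j ∈ C

theorem pair_mem_diffColouring {d : ℕ} {C : Set M} {x : Fin (d + 1) → M} {v : Fin d → M}
    (h : HasDifferences x v) {j : M} :
    pair (tuple x) j ∈ diffColouring d C ↔ Increasing x ∧ pair (tuple v) j ∈ C := by
  rw [diffColouring, pair_mem_tupleSet]
  exact and_congr_right fun _ => ⟨fun ⟨w, hw, hC⟩ => h.unique hw ▸ hC, fun hC => ⟨v, h, hC⟩⟩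

theorem BoundedDef.increasing {ι : Type} {n : ℕ} {x : Fin n → (ι → M) → M}
    (hx : ∀ i, TermDef (x i)) : BoundedDef S fun y => Increasing fun i => x i y :=
  .forall_fin fun i => .forall_fin fun j => if h : i < j
    then (BoundedDef.lt (hx i) (hx j)).congr fun _ => ⟨fun hlt _ => hlt, fun hlt => hlt h⟩
    else (BoundedDef.eq (.const 0) (.const 0)).congr fun _ => by simp [h]

theorem diffColouring_mem (hS : IsModelRCA0 S) (d : ℕ) {C : Set M} (hC : C ∈ S) :
    diffColouring d C ∈ S := by
  refine hS.tupleSet_mem <| .and (.increasing fun i => .var (Sum.inl i)) ?_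
  have key : BoundedDef S fun y : Fin (d + 1) ⊕ Fin 1 → M => ∃ v : Fin d → M,
      (∀ i, v i < tuple (y ∘ Sum.inl) + 1) ∧
        (HasDifferences (y ∘ Sum.inl) v ∧ pair (tuple v) (y (.inr 0)) ∈ C) :=
    .bex_fin (.add (.tuple fun i => .var _) (.const 1)) <|
      .and (.forall_fin fun i => .eq (.var _) (.add (.var _) (.var _)))
        (.mem (.pair (.tuple fun i => .var _) (.var _)) hC)
  refine key.congr fun y => exists_congr fun v => and_iff_right_of_imp fun h i => ?_
  rw [Order.lt_add_one_iff]
  exact le_add_self.trans ((h.1 i).symm.le.trans (le_tuple (y ∘ Sum.inl) i.succ))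

theorem isColouring_diffColouring {d : ℕ} {C : Set M} {k : M}
    (hC : IsColouring (fun _ : Fin d → M => True) C k) :
    IsColouring (fun x : Fin (d + 1) → M => Increasing x) (diffColouring d C) k := by
  refine isColouring_tupleSet (fun x j ⟨hx, v, _, h⟩ => ⟨hx, hC.lt h⟩) fun x hx => ?_
  obtain ⟨v, hv⟩ := HasDifferences.exists_of_strictMono (increasing_iff_strictMono.1 hx)
  obtain ⟨j, hj, hunique⟩ := hC.2 v trivial
  exact ⟨j, ⟨hx, v, hv, hj⟩, fun i ⟨_, w, hw, hi⟩ => hunique i (hv.unique hw ▸ hi)⟩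

theorem zInvariant_diffColouring (d : ℕ) (C : Set M) : ZInvariant (d + 1) (diffColouring d C) := by
  intro x hx z j
  obtain ⟨v, hv⟩ := HasDifferences.exists_of_strictMono (increasing_iff_strictMono.1 hx)
  rw [pair_mem_diffColouring hv, pair_mem_diffColouring (hv.add_const z), increasing_iff_strictMono,
    increasing_iff_strictMono, hv.strictMono_iff, (hv.add_const z).strictMono_iff]

theorem satApAHT_of_satSepZRT (hS : IsModelRCA0 S) {d : ℕ} (h : SatSepZRT (d + 1) S) :
    SatApAHT d S := by
  intro k C hCS hC
  obtain ⟨X, hXS, hu, hsep, i, hi⟩ := h k _ (diffColouring_mem hS d hCS)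
    (isColouring_diffColouring hC) (zInvariant_diffColouring d C)
  have hX := hsep.hasIncreasingGaps hS hXS hu
  obtain ⟨x₀, hx₀⟩ := hS.exists_isLeast (P := (· ∈ X)) (.mem (.var 0) hXS)
    ((hu 0).imp fun _ h => h.1)
  refine ⟨gapSet X, hX.gapSet_mem hS, hX.unbounded_gapSet hS, hsep.apart_gapSet hS hXS hu,
    gapSum X x₀, gapSum_mem hS hXS x₀, hX.isSumFunction_gapSum hS hx₀, i, fun z hz => ?_⟩
  obtain ⟨x, hx, hxX, hxz⟩ := hX.exists_hasDifferences_of_isAFS hS hz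
  exact ((pair_mem_diffColouring hxz).1 (hi x hx hxX)).2

end GapSets

theorem satSepZRT_iff_satApAHT {M : Type*} [Zero M] [One M] [Add M] [Mul M] [LT M]
    {S : Set (Set M)} (hS : IsModelRCA0 S) (d : ℕ) : SatSepZRT (d + 1) S ↔ SatApAHT d S :=
  let _ := hS.discreteOrderedSemiring
  ⟨satApAHT_of_satSepZRT hS, satSepZRT_of_satApAHT hS⟩

end SecondOrderArith

/-! ### Decidability relative to an oracle -/

namespace Weihrauch

/-- The total functional `F` is a Turing functional. -/
def Computes (F : (ℕ → ℕ) → ℕ → ℕ) : Prop :=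
  IsTuringFunctional fun X n => Part.some (F X n)

namespace Computes

variable {F G : (ℕ → ℕ) → ℕ → ℕ}

theorem pair (hF : Computes F) (hG : Computes G) :
    Computes fun X n => Nat.pair (F X n) (G X n) := by
  simpa only [Computes, Part.map_eq_map, Part.map_some, Seq.seq, Part.bind_eq_bind, Part.bind_some]
    using IsTuringFunctional.pair hF hG

theorem comp (hF : Computes F) (hG : Computes G) : Computes fun X n => F X (G X n) := by
  simpa only [Computes, Part.bind_eq_bind, Part.bind_some] using IsTuringFunctional.comp hF hG

theorem prec (hF : Computes F) (hG : Computes G) : Computes fun X n =>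
    Nat.rec (F X n.unpair.1) (fun y ih => G X (Nat.pair n.unpair.1 (Nat.pair y ih)))
      n.unpair.2 := by
  refine (congrArg IsTuringFunctional (funext₂ fun X n => ?_)).mp (IsTuringFunctional.prec hF hG)
  dsimp only
  induction n.unpair.2 with
  | zero => rfl
  | succ y ih =>
    simp only [ih]
    exact Part.bind_some _ _

theorem of_natPrimrec {f : ℕ → ℕ} (hf : Nat.Primrec f) : Computes fun _ n => f n := by
  induction hf with
  | zero => exact .zero
  | succ => exact .succ
  | left => exact .left
  | right => exact .right
  | pair _ _ hf hg => exact hf.pair hg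
  | comp _ _ hf hg => exact hf.comp hg
  | prec _ _ hf hg => exact hf.prec hg

theorem of_primrec {f : ℕ → ℕ} (hf : Primrec f) : Computes fun _ n => f n :=
  of_natPrimrec (Primrec.nat_iff.1 hf)

theorem id : Computes fun _ n => n :=
  of_primrec .id

theorem const (k : ℕ) : Computes fun _ _ => k :=
  of_primrec (.const k)

theorem fst : Computes fun _ n => n.unpair.1 :=
  .left

theorem snd : Computes fun _ n => n.unpair.2 :=
  .right

theorem oracle (hF : Computes F) : Computes fun X n => X (F X n) :=
  comp (F := fun X n => X n) IsTuringFunctional.oracle hF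

theorem of_primrec₂ {f : ℕ → ℕ → ℕ} (hf : Primrec₂ f) (hF : Computes F) (hG : Computes G) :
    Computes fun X n => f (F X n) (G X n) := by
  simpa only [Nat.unpaired, Nat.unpair_pair]
    using (of_natPrimrec (Primrec₂.unpaired'.2 hf)).comp (hF.pair hG)

theorem add (hF : Computes F) (hG : Computes G) : Computes fun X n => F X n + G X n :=
  of_primrec₂ Primrec.nat_add hF hG

theorem sub (hF : Computes F) (hG : Computes G) : Computes fun X n => F X n - G X n :=
  of_primrec₂ Primrec.nat_sub hF hG

theorem mul (hF : Computes F) (hG : Computes G) : Computes fun X n => F X n * G X n :=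
  of_primrec₂ Primrec.nat_mul hF hG

theorem sum_range {H : (ℕ → ℕ) → ℕ → ℕ → ℕ} (hH : Computes fun X n => H X n.unpair.1 n.unpair.2)
    (hG : Computes G) : Computes fun X n => ∑ i ∈ Finset.range (G X n), H X n i := by
  have hstep : Computes fun X n => n.unpair.2.unpair.2 + H X n.unpair.1 n.unpair.2.unpair.1 := by
    have := hH.comp (fst.pair (fst.comp snd))
    simp only [Nat.unpair_pair] at this
    exact (snd.comp snd).add this
  have h := ((const 0).prec hstep).comp (id.pair hG)
  simp only [Nat.unpair_pair] at h
  refine (congrArg Computes (funext₂ fun X n => ?_)).mp h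
  induction G X n with
  | zero => rfl
  | succ k ih => rw [Finset.sum_range_succ, ← ih]

end Computes

/-- The relation `p` between an oracle and a number is decidable, uniformly in the oracle. The
value `0` stands for truth, as in the unbounded search of `IsTuringFunctional.rfind`. -/
def Decides (p : (ℕ → ℕ) → ℕ → Prop) : Prop :=
  ∃ F, Computes F ∧ ∀ X n, F X n = 0 ↔ p X n

namespace Decides

variable {F G : (ℕ → ℕ) → ℕ → ℕ} {p q : (ℕ → ℕ) → ℕ → Prop}

theorem le (hF : Computes F) (hG : Computes G) : Decides fun X n => F X n ≤ G X n :=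
  ⟨_, hF.sub hG, fun _ _ => Nat.sub_eq_zero_iff_le⟩

theorem and (hp : Decides p) (hq : Decides q) : Decides fun X n => p X n ∧ q X n := by
  obtain ⟨F, hF, hFp⟩ := hp
  obtain ⟨G, hG, hGq⟩ := hq
  exact ⟨_, hF.add hG, fun X n => Nat.add_eq_zero_iff.trans (and_congr (hFp X n) (hGq X n))⟩

theorem not (hp : Decides p) : Decides fun X n => ¬ p X n := by
  obtain ⟨F, hF, hFp⟩ := hp
  refine ⟨_, (Computes.const 1).sub hF, fun X n => ?_⟩
  rw [Nat.sub_eq_zero_iff_le, Nat.one_le_iff_ne_zero, Ne, hFp]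

theorem congr (hp : Decides p) (h : ∀ X n, p X n ↔ q X n) : Decides q := by
  obtain ⟨F, hF, hFp⟩ := hp
  exact ⟨F, hF, fun X n => (hFp X n).trans (h X n)⟩

theorem lt (hF : Computes F) (hG : Computes G) : Decides fun X n => F X n < G X n :=
  (le hG hF).not.congr fun _ _ => not_le

theorem eq (hF : Computes F) (hG : Computes G) : Decides fun X n => F X n = G X n :=
  ((le hF hG).and (le hG hF)).congr fun _ _ => antisymm_iff

theorem imp (hp : Decides p) (hq : Decides q) : Decides fun X n => p X n → q X n :=
  (hp.and hq.not).not.congr fun _ _ => not_and_not_right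

theorem mem_support (hF : Computes F) : Decides fun X n => F X n ∈ Function.support X :=
  (eq hF.oracle (.const 0)).not

theorem forall_lt {p : (ℕ → ℕ) → ℕ → ℕ → Prop} (hp : Decides fun X n => p X n.unpair.1 n.unpair.2)
    (hG : Computes G) : Decides fun X n => ∀ i < G X n, p X n i := by
  obtain ⟨F, hF, hFp⟩ := hp
  have hsum := Computes.sum_range (H := fun X n i => F X (Nat.pair n i))
    (by simpa only [Nat.pair_unpair] using hF) hG
  refine ⟨_, hsum, fun X n => ?_⟩
  simp only [Finset.sum_eq_zero_iff, Finset.mem_range, hFp, Nat.unpair_pair]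

theorem exists_lt {p : (ℕ → ℕ) → ℕ → ℕ → Prop} (hp : Decides fun X n => p X n.unpair.1 n.unpair.2)
    (hG : Computes G) : Decides fun X n => ∃ i < G X n, p X n i :=
  (forall_lt (p := fun X n i => ¬ p X n i) hp.not hG).not.congr fun _ _ => by
    simp only [not_forall, not_not, exists_prop]

theorem of_primrecPred {r : ℕ → Prop} (hr : PrimrecPred r) : Decides fun _ n => r n := by
  obtain ⟨_, hr⟩ := hr
  have : Primrec fun n => if r n then 0 else 1 := .ite ⟨_, hr⟩ (.const 0) (.const 1)
  exact ⟨_, .of_primrec this, fun _ n => by simp⟩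

theorem ite [∀ X n, Decidable (p X n)] (hp : Decides p) (hG : Computes G) :
    Computes fun X n => if p X n then G X n else 0 := by
  obtain ⟨F, hF, hFp⟩ := hp
  refine (congrArg Computes (funext₂ fun X n => ?_)).mp (((Computes.const 1).sub hF).mul hG)
  split_ifs with h
  · rw [(hFp X n).2 h, Nat.sub_zero, one_mul]
  · rw [Nat.sub_eq_zero_of_le (Nat.one_le_iff_ne_zero.2 (mt (hFp X n).1 h)), zero_mul]

end Decides

theorem setCode_eq_ite (Z : Set ℕ) (n : ℕ) [Decidable (n ∈ Z)] :
    setCode Z n = if n ∈ Z then 1 else 0 :=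
  Set.indicator_apply Z 1 n

theorem support_setCode (Z : Set ℕ) : Function.support (setCode Z) = Z := by
  classical
  ext n
  simp [setCode_eq_ite]

open Classical in
theorem Decides.setCode {p : (ℕ → ℕ) → ℕ → Prop} (hp : Decides p) :
    Computes fun X n => setCode {n | p X n} n := by
  simpa only [setCode_eq_ite, Set.mem_ofPred_eq] using hp.ite (.const 1)

theorem Decides.exists_isTuringFunctional_rfind {p : (ℕ → ℕ) → ℕ → ℕ → Prop} {G : (ℕ → ℕ) → ℕ → ℕ}
    (hp : Decides fun X n => p X n.unpair.1 n.unpair.2) (hG : Computes G) :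
    ∃ Ψ, IsTuringFunctional Ψ ∧
      ∀ X n, (∃ a, p X n a) → ∃ a, p X n a ∧ Ψ X n = Part.some (G X (Nat.pair n a)) := by
  obtain ⟨F, hF, hFp⟩ := hp
  refine ⟨_, .comp hG (.pair Computes.id (.rfind hF)), fun X n ⟨b, hb⟩ => ?_⟩
  have hdecide a : decide (F X (Nat.pair n a) = 0) = true ↔ p X n a := by
    simp only [decide_eq_true_eq, hFp, Nat.unpair_pair]
  obtain ⟨a, ha, -⟩ := Nat.rfind_min' (p := fun a => decide (F X (Nat.pair n a) = 0))
    ((hdecide b).2 hb)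
  have hpa : p X n a := (hdecide a).1 (by simpa using Nat.rfind_spec ha)
  have hrfind : (Nat.rfind fun a => Part.some (decide (F X (Nat.pair n a) = 0))) = Part.some a :=
    Part.eq_some_iff.2 ha
  refine ⟨a, hpa, ?_⟩
  simp [Seq.seq, hrfind]

theorem Decides.exists_isTuringFunctional_setCode {p q : (ℕ → ℕ) → ℕ → ℕ → Prop}
    (hp : Decides fun X n => p X n.unpair.1 n.unpair.2)
    (hq : Decides fun X n => q X n.unpair.1 n.unpair.2) :
    ∃ Ψ, IsTuringFunctional Ψ ∧ ∀ (X : ℕ → ℕ) (Z : Set ℕ), (∀ n, ∃ a, p X n a) →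
      (∀ n a, p X n a → (n ∈ Z ↔ q X n a)) → ∀ n, Ψ X n = Part.some (Weihrauch.setCode Z n) := by
  classical
  obtain ⟨Ψ, hΨ, hpΨ⟩ := hp.exists_isTuringFunctional_rfind hq.setCode
  refine ⟨Ψ, hΨ, fun X Z hex hZ n => ?_⟩
  obtain ⟨a, ha, hΨa⟩ := hpΨ X n (hex n)
  simp only [hΨa, setCode_eq_ite, Set.mem_ofPred_eq, Nat.unpair_pair, hZ n a ha]

end Weihrauch

/-! ### Codes of colourings -/

namespace Weihrauch

open Encodable Denumerable

/-- The set of the values of an increasing tuple. -/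
def Subsets.ofStrictMono {n : ℕ} (x : Fin n → ℕ) (hx : StrictMono x) : Subsets n :=
  ⟨Finset.univ.map ⟨x, hx.injective⟩, by simp⟩

namespace Subsets

variable {n : ℕ} {x : Fin n → ℕ}

theorem coe_ofStrictMono (hx : StrictMono x) : ((ofStrictMono x hx).1 : Set ℕ) = Set.range x := by
  simp [ofStrictMono]

theorem exists_eq_ofStrictMono (s : Subsets n) : ∃ x hx, s = ofStrictMono x hx := by
  refine ⟨s.1.orderEmbOfFin s.2, (s.1.orderEmbOfFin s.2).strictMono, Subtype.ext ?_⟩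
  rw [← Finset.coe_inj, coe_ofStrictMono, Finset.range_orderEmbOfFin]

theorem shift_ofStrictMono (hx : StrictMono x) (z : ℕ) :
    (ofStrictMono x hx).shift z = ofStrictMono (fun i => x i + z) (hx.add_const z) :=
  Subtype.ext (Finset.map_map _ _ _)

theorem orderEmbOfFin_ofStrictMono (hx : StrictMono x) :
    ⇑((ofStrictMono x hx).1.orderEmbOfFin (ofStrictMono x hx).2) = x :=
  (Finset.orderEmbOfFin_unique _ (fun i => by simp [ofStrictMono]) hx).symm

end Subsets

section Codes

variable {n : ℕ}

theorem pairwise_ofFn_iff {x : Fin n → ℕ} : (List.ofFn x).Pairwise (· < ·) ↔ StrictMono x :=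
  List.pairwise_ofFn

theorem subsetColouringCode_encode_ofFn (c : Subsets n → ℕ) {x : Fin n → ℕ} (hx : StrictMono x) :
    subsetColouringCode c (encode (List.ofFn x)) = c (.ofStrictMono x hx) := by
  have h : (ofNat (List ℕ) (encode (List.ofFn x))).Pairwise (· < ·) ∧
      (ofNat (List ℕ) (encode (List.ofFn x))).length = n := by
    rw [ofNat_encode]
    exact ⟨pairwise_ofFn_iff.2 hx, List.length_ofFn⟩
  rw [subsetColouringCode, dif_pos h]
  congr 1
  apply Subtype.ext
  ext a
  simp [Subsets.ofStrictMono, List.mem_ofFn]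

theorem subsetColouringCode_encode_of_not (c : Subsets n → ℕ) {l : List ℕ}
    (h : ¬ (l.Pairwise (· < ·) ∧ l.length = n)) : subsetColouringCode c (encode l) = 0 :=
  dif_neg (by rwa [ofNat_encode])

theorem tupleColouringCode_encode_ofFn (c : (Fin n → ℕ) → ℕ) (x : Fin n → ℕ) :
    tupleColouringCode c (encode (List.ofFn x)) = c x := by
  have h : (ofNat (List ℕ) (encode (List.ofFn x))).length = n := by simp
  rw [tupleColouringCode, dif_pos h]
  congr 1
  funext i
  simp

theorem tupleColouringCode_encode_of_length_ne (c : (Fin n → ℕ) → ℕ) {l : List ℕ}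
    (h : l.length ≠ n) : tupleColouringCode c (encode l) = 0 :=
  dif_neg (by rwa [ofNat_encode])

end Codes

/-- The list of the sums of the initial segments of a list. -/
def partialSums (l : List ℕ) : List ℕ :=
  (List.range (l.length + 1)).map fun i => (l.take i).sum

/-- The list of the (truncated) successive differences of a list. -/
def differences (l : List ℕ) : List ℕ :=
  (List.range (l.length - 1)).map fun i => l.getD (i + 1) 0 - l.getD i 0

theorem partialSums_ofFn {d : ℕ} (v : Fin d → ℕ) :
    partialSums (List.ofFn v) = List.ofFn (Fin.partialSum v) := by
  refine List.ext_getElem (by simp [partialSums]) fun i h₁ h₂ => ?_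
  rw [List.getElem_ofFn]
  simp [partialSums, Fin.partialSum]

theorem differences_ofFn {d : ℕ} (x : Fin (d + 1) → ℕ) :
    differences (List.ofFn x) = List.ofFn fun i : Fin d => x i.succ - x i.castSucc := by
  refine List.ext_getElem (by simp [differences]) fun i h₁ h₂ => ?_
  have hi : i < d := by simpa [differences] using h₁
  rw [List.getElem_ofFn]
  simp [differences, -List.ofFn_succ, List.getD_eq_getElem?_getD, hi, hi.le]

theorem primrec_list_sum : Primrec (List.sum : List ℕ → ℕ) :=
  Primrec.list_foldr (f := fun l : List ℕ => l) (g := fun _ => 0) (h := fun _ p => p.1 + p.2)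
    .id (.const 0) (Primrec.nat_add.comp (Primrec.fst.comp .snd) (Primrec.snd.comp .snd))

theorem primrec_partialSums : Primrec partialSums :=
  Primrec.list_map (Primrec.list_range.comp (Primrec.succ.comp .list_length))
    (primrec_list_sum.comp (Primrec.list_take.comp .snd .fst))

theorem primrec_differences : Primrec differences :=
  Primrec.list_map (Primrec.list_range.comp (Primrec.pred.comp .list_length)) <|
    Primrec.nat_sub.comp ((Primrec.list_getD 0).comp .fst (Primrec.succ.comp .snd))
      ((Primrec.list_getD 0).comp .fst .snd)

theorem primrecPred_zero_notMem : PrimrecPred fun l : List ℕ => 0 ∉ l :=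
  (PrimrecPred.exists_mem_list (Primrec.eq.comp .id (.const 0))).not.of_eq fun l => by simp

/-- The functional that applies the oracle to the code of the list `f l`, for the lists `l` with
the property `r`. -/
def recode (f : List ℕ → List ℕ) (r : List ℕ → Prop) [DecidablePred r] (X : ℕ → ℕ) (m : ℕ) : ℕ :=
  if r (ofNat (List ℕ) m) then X (encode (f (ofNat (List ℕ) m))) else 0

theorem computes_recode {f : List ℕ → List ℕ} (hf : Primrec f) {r : List ℕ → Prop}
    [DecidablePred r] (hr : PrimrecPred r) : Computes (recode f r) :=
  (Decides.of_primrecPred (hr.comp (Primrec.ofNat (List ℕ)))).ite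
    (Computes.of_primrec (Primrec.encode.comp (hf.comp (Primrec.ofNat (List ℕ))))).oracle

theorem recode_eq {f : List ℕ → List ℕ} {r : List ℕ → Prop} [DecidablePred r] {X Z : ℕ → ℕ}
    (h : ∀ n (x : Fin n → ℕ), Z (encode (List.ofFn x)) =
      if r (List.ofFn x) then X (encode (f (List.ofFn x))) else 0) (m : ℕ) :
    recode f r X m = Z m := by
  have := (List.forall_iff_forall_tuple (P := fun l => Z (encode l) =
    if r l then X (encode (f l)) else 0)).2 h (ofNat (List ℕ) m)
  rw [recode, ← this, encode_ofNat]

/-! ### Colourings of tuples and of sets -/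

section Colourings

variable {d : ℕ}

/-- The colouring of tuples that maps `v` to the colour of the set of the partial sums of `v`, and
to `0` if `v` has an entry `0`. -/
def sumColouring (c : Subsets (d + 1) → ℕ) (v : Fin d → ℕ) : ℕ :=
  if h : StrictMono (Fin.partialSum v) then c (.ofStrictMono _ h) else 0

/-- The colouring of `d + 1`-sets that maps a set to the colour of the tuple of its successive
differences. -/
def diffColouring (c : (Fin d → ℕ) → ℕ) (s : Subsets (d + 1)) : ℕ :=
  c fun i => s.1.orderEmbOfFin s.2 i.succ - s.1.orderEmbOfFin s.2 i.castSucc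

/-- The colour under `c` of a set is the colour under `e` of the tuple of its successive
differences. -/
def Corresponds (c : Subsets (d + 1) → ℕ) (e : (Fin d → ℕ) → ℕ) : Prop :=
  ∀ (x : Fin (d + 1) → ℕ) (hx : StrictMono x) (v : Fin d → ℕ), HasDifferences x v →
    c (.ofStrictMono x hx) = e v

theorem corresponds_sumColouring {c : Subsets (d + 1) → ℕ} (hc : ZInvariant c) :
    Corresponds c (sumColouring c) := by
  intro x hx v hv
  have h : StrictMono (Fin.partialSum v) :=
    (HasDifferences.partialSum v).strictMono_iff.2 (hv.strictMono_iff.1 hx)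
  rw [sumColouring, dif_pos h, ← hc (.ofStrictMono _ h) (x 0), Subsets.shift_ofStrictMono]
  congr
  exact funext hv.eq_partialSum_add

theorem corresponds_diffColouring (c : (Fin d → ℕ) → ℕ) : Corresponds (diffColouring c) c := by
  intro x hx v hv
  rw [diffColouring, Subsets.orderEmbOfFin_ofStrictMono, hv.sub_eq]

theorem Corresponds.zInvariant {c : Subsets (d + 1) → ℕ} {e : (Fin d → ℕ) → ℕ}
    (h : Corresponds c e) : ZInvariant c := by
  intro s z
  obtain ⟨x, hx, rfl⟩ := s.exists_eq_ofStrictMono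
  obtain ⟨v, hv⟩ := HasDifferences.exists_of_strictMono hx
  rw [Subsets.shift_ofStrictMono, h _ _ _ hv, h _ _ _ (hv.add_const z)]

theorem recode_subsetColouringCode (c : Subsets (d + 1) → ℕ) (m : ℕ) :
    recode partialSums (fun l => l.length = d ∧ 0 ∉ l) (subsetColouringCode c) m =
      tupleColouringCode (sumColouring c) m := by
  refine recode_eq (fun n v => ?_) m
  rcases eq_or_ne n d with rfl | hn
  · have hv : 0 ∉ List.ofFn v ↔ StrictMono (Fin.partialSum v) := by
      rw [(HasDifferences.partialSum v).strictMono_iff, List.mem_ofFn, not_exists]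
    rw [tupleColouringCode_encode_ofFn, sumColouring]
    split_ifs with h h' h'
    · rw [partialSums_ofFn, subsetColouringCode_encode_ofFn]
    · exact absurd ⟨List.length_ofFn, hv.2 h⟩ h'
    · exact absurd (hv.1 h'.2) h
    · rfl
  · rw [if_neg fun h => hn (List.length_ofFn.symm.trans h.1),
      tupleColouringCode_encode_of_length_ne _ (List.length_ofFn.trans_ne hn)]

theorem recode_tupleColouringCode (c : (Fin d → ℕ) → ℕ) (m : ℕ) :
    recode differences (fun l => l.length = d + 1 ∧ 0 ∉ differences l) (tupleColouringCode c) m =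
      subsetColouringCode (diffColouring c) m := by
  refine recode_eq (fun n x => ?_) m
  rcases eq_or_ne n (d + 1) with rfl | hn
  · have hx : 0 ∉ differences (List.ofFn x) ↔ StrictMono x := by
      rw [differences_ofFn, List.mem_ofFn, not_exists, Fin.strictMono_iff_lt_succ]
      exact forall_congr' fun i => Nat.sub_ne_zero_iff_lt
    split_ifs with h
    · rw [subsetColouringCode_encode_ofFn _ (hx.1 h.2), diffColouring,
        Subsets.orderEmbOfFin_ofStrictMono, differences_ofFn, tupleColouringCode_encode_ofFn]
    · refine subsetColouringCode_encode_of_not _ fun h' => h ⟨h'.2, hx.2 ?_⟩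
      exact pairwise_ofFn_iff.1 h'.1
  · rw [if_neg fun h => hn (List.length_ofFn.symm.trans h.1),
      subsetColouringCode_encode_of_not _ fun h => hn (List.length_ofFn.symm.trans h.2)]

end Colourings

/-! ### Reduction of the `ℤ`-Ramsey theorem to the adjacent Hindman theorem -/

section Solutions

variable {x y : ℕ → ℕ}

theorem exists_strictMono_range_eq {X : Set ℕ} (h : X.Infinite) :
    ∃ x : ℕ → ℕ, StrictMono x ∧ Set.range x = X :=
  ⟨Nat.nth (· ∈ X), Nat.nth_strictMono h, Nat.range_nth_of_infinite h⟩

theorem infinite_range (hx : StrictMono x) : (Set.range x).Infinite :=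
  Set.infinite_range_of_injective hx.injective

theorem enum_range (hx : StrictMono x) : enum (Set.range x) = x :=
  ((Nat.nth_strictMono (infinite_range hx)).range_inj hx).1
    (Nat.range_nth_of_infinite (infinite_range hx))

theorem lt_of_mu_lt_lam {a b : ℕ} (h : mu a < lam b) : a < b := by
  have hb : b ≠ 0 := by
    rintro rfl
    simp [lam] at h
  calc a < 2 ^ (mu a + 1) := Nat.lt_pow_succ_log_self (by norm_num) a
    _ ≤ 2 ^ lam b := Nat.pow_le_pow_right (by norm_num) h
    _ ≤ b := Nat.le_of_dvd (Nat.pos_of_ne_zero hb) pow_padicValNat_dvd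

theorem Apart.strictMono (h : Apart y) : StrictMono y :=
  strictMono_nat_of_lt_succ fun n => lt_of_mu_lt_lam (h n).2

theorem strictMono_of_ne_zero (hxy : ∀ n, x (n + 1) = x n + y n) (hy : ∀ n, y n ≠ 0) :
    StrictMono x :=
  strictMono_nat_of_lt_succ fun n => by
    rw [hxy]
    exact Nat.lt_add_of_pos_right (Nat.pos_of_ne_zero (hy n))

theorem separated_range_iff (hx : StrictMono x) (hxy : ∀ n, x (n + 1) = x n + y n) :
    Separated (Set.range x) ↔ Apart y := by
  have hy n : y n ≠ 0 := fun h => (hx n.lt_succ_self).ne (by rw [hxy, h, add_zero])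
  simp only [Separated, Apart, enum_range hx, hxy, Nat.add_sub_cancel_left, hy, ne_eq,
    not_false_eq_true, true_and]

theorem add_sum_Ico (hxy : ∀ n, x (n + 1) = x n + y n) {a b : ℕ} (hab : a ≤ b) :
    x a + ∑ t ∈ Finset.Ico a b, y t = x b := by
  induction b, hab using Nat.le_induction with
  | base => simp
  | succ b hab ih => rw [Finset.sum_Ico_succ_top hab, ← add_assoc, ih, hxy]

theorem mem_AFS_iff (hxy : ∀ n, x (n + 1) = x n + y n) {d : ℕ} {v : Fin d → ℕ} :
    v ∈ AFS d y ↔ ∃ k : Fin (d + 1) → ℕ, StrictMono k ∧ HasDifferences (x ∘ k) v := by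
  refine exists_congr fun k => and_congr_right fun hk => forall_congr' fun j => ?_
  rw [Function.comp_apply, Function.comp_apply, ← add_sum_Ico hxy (hk j.castSucc_lt_succ).le,
    add_right_inj, eq_comm]

theorem forall_subset_range_iff (hx : StrictMono x) {n : ℕ} {P : Subsets n → Prop} :
    (∀ s : Subsets n, (s.1 : Set ℕ) ⊆ Set.range x → P s) ↔
      ∀ k (hk : StrictMono k), P (.ofStrictMono (x ∘ k) (hx.comp hk)) := by
  constructor
  · intro h k hk
    refine h _ ?_
    rw [Subsets.coe_ofStrictMono]
    exact Set.range_comp_subset_range _ _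
  · intro h s hs
    obtain ⟨z, hz, rfl⟩ := s.exists_eq_ofStrictMono
    rw [Subsets.coe_ofStrictMono] at hs
    choose k hk using fun i => hs ⟨i, rfl⟩
    obtain rfl : x ∘ k = z := funext hk
    exact h k fun i j hij => hx.lt_iff_lt.1 (hz hij)

theorem isSol_range_iff {d : ℕ} {c : (sepZRT (d + 1)).Inst} {e : (apAHT d).Inst}
    (h : Corresponds c.1 e.1) (hx : StrictMono x) (hy : StrictMono y)
    (hxy : ∀ n, x (n + 1) = x n + y n) :
    (sepZRT (d + 1)).IsSol c (Set.range x) ↔ (apAHT d).IsSol e (Set.range y) := by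
  simp only [sepZRT, apAHT, infinite_range hx, infinite_range hy, true_and,
    separated_range_iff hx hxy, enum_range hy, forall_subset_range_iff hx, mem_AFS_iff hxy]
  refine and_congr_right fun _ => exists_congr fun i => ⟨?_, fun hi k hk => ?_⟩
  · rintro hi v ⟨k, hk, hv⟩
    rw [← hi k hk, h _ _ _ hv]
  · obtain ⟨v, hv⟩ := HasDifferences.exists_of_strictMono (hx.comp hk)
    rw [h _ _ _ hv, hi v ⟨k, hk, hv⟩]

end Solutions

section SumsOfInitialSegments

variable {y : ℕ → ℕ}

theorem sum_mul_setCode_range (hy : StrictMono y) [DecidablePred (· ∈ Set.range y)] (m : ℕ) :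
    ∑ i ∈ Finset.range m, i * setCode (Set.range y) i =
      ∑ t ∈ Finset.range (Nat.count (· ∈ Set.range y) m), y t := by
  induction m with
  | zero => simp
  | succ m ih =>
    rw [Finset.sum_range_succ, ih, Nat.count_succ, setCode_eq_ite]
    split_ifs with hm
    · have : y (Nat.count (· ∈ Set.range y) m) = m :=
        (congrFun (enum_range hy) _).symm.trans (Nat.nth_count hm)
      rw [Finset.sum_range_succ, this, mul_one]
    · rfl

theorem mem_range_sum_iff (hy : StrictMono y) {n : ℕ} :
    n ∈ Set.range (fun k => ∑ t ∈ Finset.range k, y t) ↔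
      ∃ m < n + 2, ∑ i ∈ Finset.range m, i * setCode (Set.range y) i = n := by
  classical
  simp only [sum_mul_setCode_range hy]
  refine ⟨?_, fun ⟨m, _, h⟩ => ⟨_, h⟩⟩
  rintro ⟨_ | k, rfl⟩
  · exact ⟨0, by simp, by simp⟩
  · have hle : y k ≤ ∑ t ∈ Finset.range (k + 1), y t := by
      rw [Finset.sum_range_succ]
      exact Nat.le_add_left _ _
    refine ⟨y k + 1, Nat.lt_succ_of_le (Nat.succ_le_succ hle), ?_⟩
    have := Nat.count_nth_succ_of_infinite (p := (· ∈ Set.range y)) (infinite_range hy) k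
    rw [show Nat.nth (· ∈ Set.range y) = y from enum_range hy] at this
    rw [this]

theorem exists_isTuringFunctional_sums : ∃ Ψ, IsTuringFunctional Ψ ∧
    ∀ y : ℕ → ℕ, StrictMono y → ∀ n, Ψ (setCode (Set.range y)) n =
      Part.some (setCode (Set.range fun k => ∑ t ∈ Finset.range k, y t) n) := by
  have hsum : Computes fun X m => ∑ i ∈ Finset.range m, i * X i :=
    Computes.sum_range (H := fun X _ i => i * X i) (.mul .snd (.oracle .snd)) .id
  have hp : Decides fun X n => ∃ m < n + 2, ∑ i ∈ Finset.range m, i * X i = n :=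
    .exists_lt (p := fun X n m => ∑ i ∈ Finset.range m, i * X i = n)
      (.eq (hsum.comp .snd) .fst) (.add .id (.const 2))
  classical
  refine ⟨_, hp.setCode, fun y hy n => ?_⟩
  simp only [setCode_eq_ite, mem_range_sum_iff hy, Set.mem_ofPred_eq]

end SumsOfInitialSegments

theorem sepZRT_reducible_apAHT (d : ℕ) : StrongReducible (sepZRT (d + 1)) (apAHT d) := by
  have hΦ : Computes (recode partialSums fun l => l.length = d ∧ 0 ∉ l) :=
    computes_recode primrec_partialSums
      ((Primrec.eq.comp .list_length (.const d)).and primrecPred_zero_notMem)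
  obtain ⟨Ψ, hΨ, hsums⟩ := exists_isTuringFunctional_sums
  refine ⟨_, Ψ, hΦ, hΨ, ?_⟩
  rintro ⟨c, ⟨k, hk⟩, hc⟩
  have hbound v : sumColouring c v < k + 1 := by
    rw [sumColouring]
    split_ifs
    exacts [Nat.lt_succ_of_lt (hk _), k.succ_pos]
  refine ⟨⟨sumColouring c, k + 1, hbound⟩, fun m => congrArg Part.some
    (recode_subsetColouringCode c m), fun Y hY => ?_⟩
  obtain ⟨y, hy, rfl⟩ := exists_strictMono_range_eq hY.1
  have hxy n := Finset.sum_range_succ y n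
  have hap : Apart y := enum_range hy ▸ hY.2.1
  exact ⟨_, hsums y hy, (isSol_range_iff (corresponds_sumColouring hc)
    (strictMono_of_ne_zero hxy fun n => (hap n).1) hy hxy).2 hY⟩

end Weihrauch

/-! ### Sets with increasing gaps in the standard model -/

namespace SecondOrderArith

section StandardModel

instance : DiscreteOrderedSemiring ℕ where

theorem isModelRCA0_nat_univ : IsModelRCA0 (Set.univ : Set (Set ℕ)) where
  nonempty := ⟨_, Set.mem_univ ∅⟩
  succ_ne_zero := Nat.succ_ne_zero
  succ_inj _ _ := Nat.succ.inj
  add_zero _ := rfl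
  add_succ _ _ := rfl
  mul_zero _ := rfl
  mul_succ _ _ := rfl
  not_lt_zero := Nat.not_lt_zero
  lt_succ _ _ := Nat.lt_succ_iff_lt_or_eq
  induction _ _ h0 hsucc a := Nat.rec h0 hsucc a
  comprehension _ _ _ := Set.mem_univ _

variable {x y : ℕ → ℕ}

theorem consecutive_range_iff (hx : StrictMono x) {a b : ℕ} :
    Consecutive (Set.range x) a b ↔ ∃ n, x n = a ∧ x (n + 1) = b := by
  constructor
  · rintro ⟨⟨n, rfl⟩, ⟨m, rfl⟩, hnm, h⟩
    have hle : n + 1 ≤ m := Nat.succ_le_of_lt (hx.lt_iff_lt.1 hnm)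
    refine ⟨n, rfl, congrArg x (hle.eq_of_not_lt fun hlt => ?_)⟩
    exact h _ ⟨n + 1, rfl⟩ ⟨hx n.lt_succ_self, hx hlt⟩
  · rintro ⟨n, rfl, rfl⟩
    refine ⟨⟨n, rfl⟩, ⟨n + 1, rfl⟩, hx n.lt_succ_self, ?_⟩
    rintro _ ⟨m, rfl⟩ ⟨hnm, hmn⟩
    exact (hx.lt_iff_lt.1 hnm).not_ge (Nat.le_of_lt_succ (hx.lt_iff_lt.1 hmn))

theorem gapSet_range (hx : StrictMono x) (hxy : ∀ n, x (n + 1) = x n + y n) :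
    gapSet (Set.range x) = Set.range y := by
  ext m
  refine (exists_congr fun a => consecutive_range_iff hx).trans ?_
  simp only [hxy]
  constructor
  · rintro ⟨_, n, rfl, h⟩
    exact ⟨n, add_left_cancel h⟩
  · rintro ⟨n, rfl⟩
    exact ⟨_, n, rfl, rfl⟩

theorem hasIncreasingGaps_range (hx : StrictMono x) (hy : StrictMono y)
    (hxy : ∀ n, x (n + 1) = x n + y n) : HasIncreasingGaps Set.univ (Set.range x) := by
  refine ⟨Set.mem_univ _, fun m => ⟨_, ⟨m + 1, rfl⟩, hx.id_le (m + 1)⟩, fun a p q hp hq => ?_⟩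
  obtain ⟨n, rfl, hp⟩ := (consecutive_range_iff hx).1 hp
  obtain ⟨m, hm, hq⟩ := (consecutive_range_iff hx).1 hq
  obtain rfl : m = n + 1 := hx.injective (hm.trans hp.symm)
  rw [hxy] at hp
  rw [hxy, hm] at hq
  rw [← add_left_cancel hp, ← add_left_cancel hq]
  exact hy n.lt_succ_self

end StandardModel

end SecondOrderArith

/-! ### Reduction of the adjacent Hindman theorem to the `ℤ`-Ramsey theorem -/

namespace Weihrauch

open SecondOrderArith (GapGE Consecutive consecutive_add_iff gapSet_range hasIncreasingGaps_range
  isModelRCA0_nat_univ)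

section Gaps

variable {F G : (ℕ → ℕ) → ℕ → ℕ}

theorem Decides.gapGE (hF : Computes F) (hG : Computes G) :
    Decides fun X n => GapGE (Function.support X) (F X n) (G X n) :=
  .forall_lt (p := fun X n c => c ∈ Function.support X → c ≤ F X n)
    (.imp (.mem_support .snd) (.le .snd (hF.comp .fst))) (hF.add hG)

theorem Decides.consecutive_add (hF : Computes F) (hG : Computes G) :
    Decides fun X n => Consecutive (Function.support X) (F X n) (F X n + G X n) :=
  ((mem_support hF).and <| (mem_support (hF.add hG)).and <|
    (lt hF (hF.add hG)).and (gapGE hF hG)).congr fun _ _ => consecutive_add_iff.symm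

theorem exists_isTuringFunctional_gaps : ∃ Ψ, IsTuringFunctional Ψ ∧
    ∀ x y : ℕ → ℕ, StrictMono x → StrictMono y → (∀ n, x (n + 1) = x n + y n) →
      ∀ n, Ψ (setCode (Set.range x)) n = Part.some (setCode (Set.range y) n) := by
  obtain ⟨Ψ, hΨ, h⟩ := Decides.exists_isTuringFunctional_setCode
    (p := fun X n a => a ∈ Function.support X ∧ GapGE (Function.support X) a (n + 1))
    (q := fun X n a => ∃ b < a, Consecutive (Function.support X) b (b + n))
    (.and (.mem_support .snd) (.gapGE .snd (.add .fst (.const 1))))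
    (.exists_lt (p := fun X m b => Consecutive (Function.support X) b (b + m.unpair.1))
      (.consecutive_add .snd (.comp .fst .fst)) .snd)
  refine ⟨Ψ, hΨ, fun x y hx hy hxy => h _ _ ?_ ?_⟩ <;>
    simp only [support_setCode, ← gapSet_range hx hxy]
  · exact fun n => (hasIncreasingGaps_range hx hy hxy).exists_gapGE isModelRCA0_nat_univ (n + 1)
  · exact fun n a ha => (hasIncreasingGaps_range hx hy hxy).mem_gapSet_iff isModelRCA0_nat_univ
      ha.1 ha.2

end Gaps

theorem apAHT_reducible_sepZRT (d : ℕ) : StrongReducible (apAHT d) (sepZRT (d + 1)) := by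
  have hΦ : Computes (recode differences fun l => l.length = d + 1 ∧ 0 ∉ differences l) :=
    computes_recode primrec_differences
      ((Primrec.eq.comp .list_length (.const (d + 1))).and
        (primrecPred_zero_notMem.comp primrec_differences))
  obtain ⟨Ψ, hΨ, hgaps⟩ := exists_isTuringFunctional_gaps
  refine ⟨_, Ψ, hΦ, hΨ, ?_⟩
  rintro ⟨c, k, hk⟩
  have hcorr := corresponds_diffColouring c
  refine ⟨⟨diffColouring c, ⟨k, fun s => hk _⟩, hcorr.zInvariant⟩, fun m => congrArg Part.some
    (recode_tupleColouringCode c m), fun X hX => ?_⟩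
  obtain ⟨x, hx, rfl⟩ := exists_strictMono_range_eq hX.1
  obtain ⟨y, hxy⟩ : ∃ y : ℕ → ℕ, ∀ n, x (n + 1) = x n + y n :=
    ⟨_, fun n => (Nat.add_sub_cancel' (hx n.lt_succ_self).le).symm⟩
  have hy : StrictMono y := ((separated_range_iff hx hxy).1 hX.2.1).strictMono
  exact ⟨_, hgaps x y hx hy hxy, (isSol_range_iff hcorr hx hy hxy).1 hX⟩

end Weihrauch

theorem theorem4 (d : ℕ) (hd : 1 ≤ d) :
    Weihrauch.StrongEquivalent (Weihrauch.sepZRT (d + 1)) (Weihrauch.apAHT d) ∧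
    ∀ (M : Type u) [Zero M] [One M] [Add M] [Mul M] [LT M] (S : Set (Set M)),
      SecondOrderArith.IsModelRCA0 S →
        (SecondOrderArith.SatSepZRT (d + 1) S ↔ SecondOrderArith.SatApAHT d S) :=
  ⟨⟨Weihrauch.sepZRT_reducible_apAHT d, Weihrauch.apAHT_reducible_sepZRT d⟩,
    fun _ _ _ _ _ _ _ hS => SecondOrderArith.satSepZRT_iff_satApAHT hS d⟩
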